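/- Let $n\ge 3$ and let $B_n=\langle \sigma_1,\dots,\sigma_{n-1}\mid \sigma_i\sigma_j=\sigma_j\sigma_i\ (|i-j|>1),\ \sigma_i\sigma_j\sigma_i=\sigma_j\sigma_i\sigma_j\ (|i-j|=1)\rangle$ be the braid group on $n$ strands. Positive braids are the products of the $\sigma_i$; $X$ is a prefix of $Y$ if $X^{-1}Y$ is positive; a simple braid is a positive braid in which any two strands cross at most once. For a braid $X$ let $\pi_X$ be the induced permutation of $\{1,\dots,n\}$, where $\pi_{\sigma_i}=(i\ \,i{+}1)$ and braids act from the right, i.e. $\pi_{XY}(k)=\pi_Y(\pi_X(k))$. For $i\le j$ put $\sigma_{[j\to i]}=\sigma_{j-1}\sigma_{j-2}\cdots\sigma_i$ (equal to $1$ if $i=j$), and let $$\Delta=\sigma_1(\sigma_2\sigma_1)\cdots(\sigma_{n-1}\cdots\sigma_1),\qquad \varepsilon=\sigma_1(\sigma_{n-1}\sigma_{n-2}\cdots\sigma_1).$$ The left normal form of a braid $Y$ is $Y=\Delta^p y_1\cdots y_m$, where $p$ is the largest integer such that $\Delta^p$ is a prefix of $Y$ and each $y_i\neq 1$ is the maximal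 simple prefix of $y_i\cdots y_m$; its canonical length is $m$ and its cycling is $\mathbf c(Y)=\Delta^p y_2\cdots y_m\,\tau^{-p}(y_1)$, where $\tau(X)=\Delta^{-1}X\Delta$ (with $\mathbf c(Y)=Y$ if $m=0$). The ultra summit set $USS(X)$ is the set of conjugates $Y$ of $X$ that have minimal canonical length among all conjugates of $X$ and satisfy $\mathbf c^k(Y)=Y$ for some $k\ge 1$. Proposition 3.3. A braid $s\in B_n$ belongs to $USS(\varepsilon)$ if and only if it is simple and $$\pi_s=(a)(1\ u_1\ u_2\ \cdots\ u_r\ n\ d_t\ d_{t-1}\ \cdots\ d_1)$$ (a product of disjoint cycles, so in particular $a\ne 1,n$) for some $u_1<u_2<\cdots<u_r$ and some $d_t>d_{t-1}>\cdots>d_1$, with $r,t\ge 0$ and $r+t+3=n$. Moreover, whenever $s$ is simple and $\pi_s$ is written in this form, $\beta^{-1}s\beta=\varepsilon$, where $$\beta=\sigma_{[d_1\to 1]}\,\sigma_{[d_2\to 1]}\cdots\sigma_{[d_t\to 1]}\,\sigma_{[b\to 2]},\qquad b=a+t-\max\{i: d_i<a\},$$ with the convention $\max\emptyset=0$. -/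

import Mathlib

namespace ArtinBraid

/-- The `n` strands (punctures), labelled `1, …, n`. -/
abbrev Puncture (n : ℕ) : Type := Set.Icc 1 n

/-- The indices `1, …, n - 1` of the Artin generators. -/
abbrev GenIndex (n : ℕ) : Type := Set.Ico 1 n

/-- The relators of the Artin presentation: `σ_i σ_j = σ_j σ_i` if `|i - j| > 1`, and
`σ_i σ_j σ_i = σ_j σ_i σ_j` if `|i - j| = 1`. -/
inductive Relator (n : ℕ) : FreeGroup (GenIndex n) → Prop
  | comm (i j : GenIndex n) (h : (i : ℕ) + 1 < j ∨ (j : ℕ) + 1 < i) :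
      Relator n (FreeGroup.of i * FreeGroup.of j * (FreeGroup.of j * FreeGroup.of i)⁻¹)
  | braid (i j : GenIndex n) (h : (j : ℕ) = i + 1 ∨ (i : ℕ) = j + 1) :
      Relator n (FreeGroup.of i * FreeGroup.of j * FreeGroup.of i *
        (FreeGroup.of j * FreeGroup.of i * FreeGroup.of j)⁻¹)

/-- The braid group on `n` strands. -/
abbrev BraidGroup (n : ℕ) : Type := PresentedGroup {w | Relator n w}

/-- The Artin generator `σ_i` for an index `i` in `{1, …, n - 1}`. -/
def gen {n : ℕ} (i : GenIndex n) : BraidGroup n := PresentedGroup.of i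

/-- The Artin generator `σ_i`, for a natural number `i`; it is only used for `1 ≤ i < n`
(other indices give `1`). -/
def sigma (n i : ℕ) : BraidGroup n :=
  if h : i ∈ Set.Ico 1 n then gen ⟨i, h⟩ else 1

/-- The left position `i` of the crossing `σ_i`. -/
def leftPos {n : ℕ} (i : GenIndex n) : Puncture n := ⟨i, i.2.1, i.2.2.le⟩

/-- The right position `i + 1` of the crossing `σ_i`. -/
def rightPos {n : ℕ} (i : GenIndex n) : Puncture n := ⟨i + 1, Nat.le_add_left 1 i, i.2.2⟩

/-- The transposition `(i  i+1)` of punctures, induced by `σ_i`. -/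
def genSwap {n : ℕ} (i : GenIndex n) : Equiv.Perm (Puncture n) :=
  Equiv.swap (leftPos i) (rightPos i)

theorem genSwap_comm {n : ℕ} (i j : GenIndex n) (h : (i : ℕ) + 1 < j ∨ (j : ℕ) + 1 < i) :
    genSwap i * genSwap j = genSwap j * genSwap i := by
  refine (Equiv.Perm.disjoint_swap_swap ?_).commute
  simp only [leftPos, rightPos, List.nodup_cons, List.mem_cons, Subtype.ext_iff,
    List.not_mem_nil, not_false_eq_true, List.nodup_nil, or_false, and_true]
  omega

theorem genSwap_braid_succ {n : ℕ} (i j : GenIndex n) (h : (j : ℕ) = i + 1) :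
    genSwap i * genSwap j * genSwap i = genSwap j * genSwap i * genSwap j := by
  have e : leftPos j = rightPos i := Subtype.ext h
  have h1 : leftPos i ≠ rightPos i := fun H => by
    have := congrArg Subtype.val H
    simp [leftPos, rightPos] at this
  have h2 : leftPos i ≠ rightPos j := fun H => by
    have := congrArg Subtype.val H
    simp only [leftPos, rightPos] at this
    omega
  have h3 : rightPos i ≠ rightPos j := fun H => by
    have := congrArg Subtype.val H
    simp only [rightPos] at this
    omega
  unfold genSwap
  rw [e, Equiv.swap_mul_swap_mul_swap h1 h2, Equiv.swap_comm (leftPos i) (rightPos i),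
    Equiv.swap_comm (rightPos i) (rightPos j), Equiv.swap_mul_swap_mul_swap h3.symm h2.symm,
    Equiv.swap_comm]

theorem genSwap_braid {n : ℕ} (i j : GenIndex n) (h : (j : ℕ) = i + 1 ∨ (i : ℕ) = j + 1) :
    genSwap i * genSwap j * genSwap i = genSwap j * genSwap i * genSwap j :=
  h.elim (genSwap_braid_succ i j) fun h => (genSwap_braid_succ j i h).symm

/-- Braids act on the punctures from the right: in `X * Y` the braid `X` acts first. Hence the
permutation of punctures is a homomorphism to the opposite of `Equiv.Perm`, in which
`f * g` means that `g` acts first. -/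
def permHom (n : ℕ) : BraidGroup n →* (Equiv.Perm (Puncture n))ᵐᵒᵖ :=
  PresentedGroup.toGroup (f := fun i => MulOpposite.op (genSwap i)) (by
    rintro _ (⟨i, j, h⟩ | ⟨i, j, h⟩)
    · simp only [map_mul, map_inv, FreeGroup.lift_apply_of, ← MulOpposite.op_mul]
      rw [genSwap_comm i j h, mul_inv_cancel]
    · simp only [map_mul, map_inv, FreeGroup.lift_apply_of, ← MulOpposite.op_mul, ← mul_assoc]
      rw [genSwap_braid i j h, mul_inv_cancel])

/-- The permutation `π_X` of the punctures induced by the braid `X`; it sends the start of each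
strand to its end, and `π_{XY}(k) = π_Y(π_X(k))`. -/
def perm {n : ℕ} (X : BraidGroup n) : Equiv.Perm (Puncture n) := (permHom n X).unop

/-- A braid is positive if it is a product of the generators `σ_i`. -/
def IsPositive {n : ℕ} (X : BraidGroup n) : Prop :=
  X ∈ Submonoid.closure (Set.range (gen (n := n)))

/-- `X` is a prefix of `Y`, i.e. `X⁻¹ Y` is positive. -/
def IsPrefix {n : ℕ} (X Y : BraidGroup n) : Prop := IsPositive (X⁻¹ * Y)

/-- The number of times that the two strands which start at the positions `j` and `k` cross each
other in the positive braid word `w`. -/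
def crossings {n : ℕ} : List (GenIndex n) → Puncture n → Puncture n → ℕ
  | [], _, _ => 0
  | i :: w, j, k =>
      (if (j = leftPos i ∧ k = rightPos i) ∨ (j = rightPos i ∧ k = leftPos i) then 1 else 0) +
        crossings w (genSwap i j) (genSwap i k)

/-- Simple braids: positive braids in which any two strands cross at most once. (All positive
words for a braid have the same crossing numbers, so one may ask for one such word.) -/
def IsSimple {n : ℕ} (X : BraidGroup n) : Prop :=
  ∃ w : List (GenIndex n), (w.map gen).prod = X ∧
    ∀ j k : Puncture n, j ≠ k → crossings w j k ≤ 1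

/-- `σ_{[j → i]} = σ_{j-1} σ_{j-2} ⋯ σ_i`, for `i ≤ j` (it is `1` if `i = j`). -/
def sigmaDown (n j i : ℕ) : BraidGroup n :=
  ((List.range' i (j - i)).reverse.map (sigma n)).prod

/-- The Garside element `Δ = σ_1 (σ_2 σ_1) (σ_3 σ_2 σ_1) ⋯ (σ_{n-1} ⋯ σ_1)`. -/
def Delta (n : ℕ) : BraidGroup n :=
  ((List.range (n - 1)).map fun k => sigmaDown n (k + 2) 1).prod

/-- `ε = σ_1 (σ_{n-1} σ_{n-2} ⋯ σ_1)`. -/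
def epsilon (n : ℕ) : BraidGroup n := sigma n 1 * sigmaDown n n 1

/-- `x` is the maximal simple prefix of `Y`. -/
structure IsMaxSimplePrefix {n : ℕ} (x Y : BraidGroup n) : Prop where
  isSimple : IsSimple x
  isPrefix : IsPrefix x Y
  greatest : ∀ y : BraidGroup n, IsSimple y → IsPrefix y Y → IsPrefix y x

/-- `Δ^p x_1 ⋯ x_r` (with `xs = [x_1, …, x_r]`) is the left normal form of `X`: the exponent `p`
is the largest one for which `Δ^p` is a prefix of `X`, and each `x_i` is a nontrivial simple
braid, namely the maximal simple prefix of `x_i ⋯ x_r`. -/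
structure IsLeftNormalForm {n : ℕ} (X : BraidGroup n) (p : ℤ) (xs : List (BraidGroup n)) :
    Prop where
  eq_prod : X = Delta n ^ p * xs.prod
  max_exponent : ∀ q : ℤ, IsPrefix (Delta n ^ q) X → q ≤ p
  ne_one : ∀ x ∈ xs, x ≠ 1
  isMaxSimplePrefix : ∀ (l₁ : List (BraidGroup n)) (x : BraidGroup n) (l₂ : List (BraidGroup n)),
    xs = l₁ ++ x :: l₂ → IsMaxSimplePrefix x (x * l₂.prod)

/-- The inner automorphism `τ`, conjugation by `Δ`: `τ(X) = Δ⁻¹ X Δ`. -/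
def tau (n : ℕ) : MulAut (BraidGroup n) := MulAut.conj (Delta n)⁻¹

/-- `Z = c(Y)` is the cycling of `Y`: if `Y` has left normal form `Δ^p y_1 ⋯ y_r`, then
`c(Y) = Δ^p y_2 ⋯ y_r τ^{-p}(y_1)`, and `c(Y) = Y` if `r = 0`. (Left normal forms are unique, so
this relation is the graph of the map `c`.) -/
inductive IsCycling {n : ℕ} : BraidGroup n → BraidGroup n → Prop
  | nil (Y : BraidGroup n) (p : ℤ) (h : IsLeftNormalForm Y p []) : IsCycling Y Y
  | cons (Y : BraidGroup n) (p : ℤ) (y : BraidGroup n) (ys : List (BraidGroup n))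
      (h : IsLeftNormalForm Y p (y :: ys)) :
      IsCycling Y (Delta n ^ p * ys.prod * (tau n ^ (-p)) y)

/-- `Y` has canonical length `r`: its left normal form has the form `Δ^p y_1 ⋯ y_r`. -/
def HasCanonicalLength {n : ℕ} (Y : BraidGroup n) (r : ℕ) : Prop :=
  ∃ (p : ℤ) (ys : List (BraidGroup n)), IsLeftNormalForm Y p ys ∧ ys.length = r

/-- The ultra summit set of `X`: the conjugates `Y` of `X` that have minimal canonical length
among all conjugates of `X` and satisfy `c^t(Y) = Y` for some `t ≥ 1`. The last condition says
that `Y` is related to itself by the transitive closure of the graph of `c`. -/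
def USS {n : ℕ} (X : BraidGroup n) : Set (BraidGroup n) :=
  {Y | IsConj X Y ∧
    (∃ r : ℕ, HasCanonicalLength Y r ∧
      ∀ (Z : BraidGroup n) (r' : ℕ), IsConj X Z → HasCanonicalLength Z r' → r ≤ r') ∧
    Relation.TransGen IsCycling Y Y}

/-- For `u = [u_1, …, u_r]` and `d = [d_1, …, d_t]`, the list
`1, u_1, …, u_r, n, d_t, …, d_1`. -/
def cycleList {n : ℕ} (hn : 1 ≤ n) (u d : List (Puncture n)) : List (Puncture n) :=
  ⟨1, le_refl 1, hn⟩ :: (u ++ ⟨n, hn, le_refl n⟩ :: d.reverse)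

/-- The permutation `f` is, in disjoint cycle notation,
`(a)(1 u_1 … u_r n d_t … d_1)` with `u_1 < ⋯ < u_r`, `d_1 < ⋯ < d_t` and `r + t + 3 = n`.
That `a, 1, u_1, …, u_r, n, d_t, …, d_1` are distinct is part of the notation. -/
structure HasEpsilonCycleForm {n : ℕ} (hn : 1 ≤ n) (f : Equiv.Perm (Puncture n))
    (a : Puncture n) (u d : List (Puncture n)) : Prop where
  nodup : (a :: cycleList hn u d).Nodup
  length_eq : u.length + d.length + 3 = n
  increasing_u : u.Pairwise (· < ·)
  increasing_d : d.Pairwise (· < ·)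
  eq_cycle : f = (cycleList hn u d).formPerm

/-- `max {i : d_i < a}`, where `d = [d_1, …, d_t]`, with the convention `max ∅ = 0`. -/
def lastBelow {n : ℕ} (a : Puncture n) (d : List (Puncture n)) : ℕ :=
  (Finset.univ.filter fun i : Fin d.length => d.get i < a).sup fun i => (i : ℕ) + 1

/-- `b = a + t - max {i : d_i < a}`. -/
def bIndex {n : ℕ} (a : Puncture n) (d : List (Puncture n)) : ℕ :=
  (a : ℕ) + d.length - lastBelow a d

/-- `β = σ_{[d_1 → 1]} σ_{[d_2 → 1]} ⋯ σ_{[d_t → 1]} σ_{[b → 2]}`. -/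
def beta {n : ℕ} (a : Puncture n) (d : List (Puncture n)) : BraidGroup n :=
  (d.map fun k => sigmaDown n (k : ℕ) 1).prod * sigmaDown n (bIndex a d) 2

end ArtinBraid

namespace ArtinBraid

variable {n : ℕ}

/-! A simple braid is determined by its permutation (`IsSimple.eq_of_perm_eq`, a form of Matsumoto's
theorem), and two strands of it cross exactly when the permutation inverts them. An identity between
simple braids can thus be checked on permutations.

The exponent sum is a conjugacy invariant, equal to `n` for `ε`. Since `Δ` has exponent sum
`n(n-1)/2`, an element of the ultra summit set, which has canonical length at most `1`, must be
simple. Conversely, for `n ≥ 4` a simple conjugate of `ε` has normal form `[s]` with `p = 0`, so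
cycling fixes it; for `n = 3`, `ε = Δ`. It remains to determine the simple conjugates of `ε`.

A simple braid of the stated cycle form is carried to `ε` one `d_i` at a time: conjugation by
`σ_{[d_1 → 1]}` keeps it simple and moves `d_1` from the descending to the ascending branch
(`IsSimple.conj_sigmaDown`). Once `d` is empty, the permutation depends only on `a`, and `σ_{[a →
2]}` finishes (`beta_conj`).

For the reverse direction, `sum_crossNum_conj` provides two conjugacy invariants: the total crossing
of the fixed strand with the others, and the total crossing of each strand with its successor in the
permutation. The first puts the fixed point in the interior. The second counts, for a simple braid,
the local extrema along the cycle. There are at most two for `ε`, and `1` and `n` already account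
for two, so the cycle rises from `1` to `n` and then falls. -/

theorem perm_mul (X Y : BraidGroup n) : perm (X * Y) = perm Y * perm X := by
  simp [perm]

theorem perm_one : perm (1 : BraidGroup n) = 1 := by
  simp [perm]

theorem perm_inv (X : BraidGroup n) : perm X⁻¹ = (perm X)⁻¹ := by
  simp [perm]

theorem perm_gen (i : GenIndex n) : perm (gen i) = genSwap i := by
  simp [perm, permHom, gen]

/-! ### Crossing numbers and exponent sum as functions on the braid group -/

/-- The property that the positions `j` and `k` are those of the crossing `σ_i`. -/
def IsCrossing (i : GenIndex n) (j k : Puncture n) : Prop :=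
  (j = leftPos i ∧ k = rightPos i) ∨ (j = rightPos i ∧ k = leftPos i)

instance (i : GenIndex n) (j k : Puncture n) : Decidable (IsCrossing i j k) :=
  inferInstanceAs (Decidable (_ ∨ _))

theorem genSwap_coe (i : GenIndex n) (j : Puncture n) :
    (genSwap i j : ℕ) =
      if (j : ℕ) = i then (i : ℕ) + 1 else if (j : ℕ) = i + 1 then (i : ℕ) else j := by
  unfold genSwap
  rw [Equiv.swap_apply_def]
  simp only [Subtype.ext_iff, leftPos, rightPos]
  split_ifs <;> rfl

theorem isCrossing_iff (i : GenIndex n) (j k : Puncture n) :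
    IsCrossing i j k ↔ ((j : ℕ) = i ∧ (k : ℕ) = i + 1) ∨ ((j : ℕ) = i + 1 ∧ (k : ℕ) = i) := by
  simp only [IsCrossing, leftPos, rightPos, Subtype.ext_iff]

theorem isCrossing_genSwap (i : GenIndex n) (j k : Puncture n) :
    IsCrossing i (genSwap i j) (genSwap i k) ↔ IsCrossing i j k := by
  simp only [isCrossing_iff, genSwap_coe]
  split_ifs <;> omega

theorem genSwap_genSwap (i : GenIndex n) (j : Puncture n) : genSwap i (genSwap i j) = j := by
  simp [genSwap]

/-- The action of `σ_i` on triples `(j, k, m)`, where `m` counts crossings of the strands at the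
positions `j` and `k`. -/
def crossStep (i : GenIndex n) : Equiv.Perm (Puncture n × Puncture n × ℤ) where
  toFun p := (genSwap i p.1, genSwap i p.2.1, p.2.2 + if IsCrossing i p.1 p.2.1 then 1 else 0)
  invFun p := (genSwap i p.1, genSwap i p.2.1, p.2.2 - if IsCrossing i p.1 p.2.1 then 1 else 0)
  left_inv p := by simp [isCrossing_genSwap, genSwap_genSwap]
  right_inv p := by simp [isCrossing_genSwap, genSwap_genSwap]

theorem crossStep_apply (i : GenIndex n) (j k : Puncture n) (m : ℤ) :
    crossStep i (j, k, m) = (genSwap i j, genSwap i k, m + if IsCrossing i j k then 1 else 0) :=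
  rfl

theorem crossStep_comm (i j : GenIndex n) (h : (i : ℕ) + 1 < j ∨ (j : ℕ) + 1 < i) :
    crossStep i * crossStep j = crossStep j * crossStep i := by
  ext1 ⟨x, y, m⟩
  have e (x : Puncture n) : genSwap i (genSwap j x) = genSwap j (genSwap i x) :=
    DFunLike.congr_fun (genSwap_comm i j h) x
  have c (i j : GenIndex n) (h : (i : ℕ) + 1 < j ∨ (j : ℕ) + 1 < i) (x y : Puncture n) :
      IsCrossing i (genSwap j x) (genSwap j y) ↔ IsCrossing i x y := by
    simp only [isCrossing_iff, genSwap_coe]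
    split_ifs <;> omega
  simp only [Equiv.Perm.mul_apply, crossStep_apply, e, c i j h, c j i h.symm, add_right_comm]

/-- On either side of the braid relation, any two of the three strands involved cross exactly once.
This makes crossing numbers well defined on braids and not only on words. -/
theorem crossStep_braid (i j : GenIndex n) (h : (j : ℕ) = i + 1 ∨ (i : ℕ) = j + 1) :
    crossStep i * crossStep j * crossStep i = crossStep j * crossStep i * crossStep j := by
  ext1 ⟨x, y, m⟩
  have e (x : Puncture n) :
      genSwap i (genSwap j (genSwap i x)) = genSwap j (genSwap i (genSwap j x)) :=
    DFunLike.congr_fun (genSwap_braid i j h) x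
  have f (i : GenIndex n) (x z : Puncture n) : genSwap i x = z ↔ x = genSwap i z :=
      ⟨fun h => by rw [← h, genSwap_genSwap], fun h => by rw [h, genSwap_genSwap]⟩
  simp only [Equiv.Perm.mul_apply, crossStep_apply, e, Prod.mk.injEq, true_and]
  simp only [IsCrossing, f]
  simp only [Subtype.ext_iff, genSwap_coe, leftPos, rightPos]
  rcases h with h | h
  · simp [h, add_assoc]
    split_ifs <;> omega
  · simp [h, add_assoc]
    split_ifs <;> omega

/-- The action of braids on triples `(j, k, m)`, where `m` is the number of crossings that the
strands at the positions `j` and `k` had so far. -/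
def crossHom (n : ℕ) : BraidGroup n →* (Equiv.Perm (Puncture n × Puncture n × ℤ))ᵐᵒᵖ :=
  PresentedGroup.toGroup (f := fun i => MulOpposite.op (crossStep i)) (by
    rintro _ (⟨i, j, h⟩ | ⟨i, j, h⟩)
    · simp only [map_mul, map_inv, FreeGroup.lift_apply_of, ← MulOpposite.op_mul]
      rw [crossStep_comm i j h, mul_inv_cancel]
    · simp only [map_mul, map_inv, FreeGroup.lift_apply_of, ← MulOpposite.op_mul, ← mul_assoc]
      rw [crossStep_braid i j h, mul_inv_cancel])

/-- The algebraic number of crossings, in the braid `X`, of the strands which start at the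
positions `j` and `k`. -/
def crossNum (X : BraidGroup n) (j k : Puncture n) : ℤ := ((crossHom n X).unop (j, k, 0)).2.2

theorem crossHom_gen (i : GenIndex n) : (crossHom n (gen i)).unop = crossStep i := by
  simp [crossHom, gen]

theorem braid_induction {P : BraidGroup n → Prop} (X : BraidGroup n) (one : P 1)
    (of : ∀ i, P (gen i)) (mul : ∀ X Y, P X → P Y → P (X * Y)) (inv : ∀ X, P X → P X⁻¹) : P X := by
  have h : X ∈ Subgroup.closure (Set.range (PresentedGroup.of (rels := {w | Relator n w}))) := by
    rw [PresentedGroup.closure_range_of]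
    trivial
  induction h using Subgroup.closure_induction with
  | mem x hx => obtain ⟨i, rfl⟩ := hx; exact of i
  | one => exact one
  | mul x y _ _ hx hy => exact mul x y hx hy
  | inv x _ hx => exact inv x hx

/-- The counter is only ever translated, by an amount independent of its current value. Hence
`crossNum` satisfies the cocycle rule `crossNum_mul`. -/
theorem crossHom_apply (X : BraidGroup n) (j k : Puncture n) (m : ℤ) :
    (crossHom n X).unop (j, k, m) = (perm X j, perm X k, m + crossNum X j k) := by
  suffices H : ∃ c : Puncture n → Puncture n → ℤ, ∀ j k m,
      (crossHom n X).unop (j, k, m) = (perm X j, perm X k, m + c j k) by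
    obtain ⟨c, hc⟩ := H
    simp [crossNum, hc]
  induction X using braid_induction with
  | one => exact ⟨fun _ _ => 0, by simp [perm_one]⟩
  | of i => exact ⟨fun j k => if IsCrossing i j k then 1 else 0, fun j k m => by
      rw [crossHom_gen, crossStep_apply, perm_gen]⟩
  | mul X Y hX hY =>
    obtain ⟨c, hc⟩ := hX
    obtain ⟨d, hd⟩ := hY
    exact ⟨fun j k => c j k + d (perm X j) (perm X k), fun j k m => by
      simp [hc, hd, perm_mul, add_assoc]⟩
  | inv X hX =>
    obtain ⟨c, hc⟩ := hX
    refine ⟨fun j k => -c ((perm X)⁻¹ j) ((perm X)⁻¹ k), fun j k m => ?_⟩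
    rw [map_inv, MulOpposite.unop_inv, Equiv.Perm.inv_eq_iff_eq, hc]
    simp [perm_inv]

theorem crossNum_mul (X Y : BraidGroup n) (j k : Puncture n) :
    crossNum (X * Y) j k = crossNum X j k + crossNum Y (perm X j) (perm X k) := by
  have h := crossHom_apply (X * Y) j k 0
  rw [map_mul, MulOpposite.unop_mul, Equiv.Perm.mul_apply, crossHom_apply, crossHom_apply] at h
  simpa using (congrArg (fun p => p.2.2) h).symm

theorem crossNum_one (j k : Puncture n) : crossNum (1 : BraidGroup n) j k = 0 := by
  simp [crossNum]

theorem crossNum_gen (i : GenIndex n) (j k : Puncture n) :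
    crossNum (gen i) j k = if IsCrossing i j k then 1 else 0 := by
  simp [crossNum, crossHom_gen, crossStep_apply]

/-- The exponent sum of a braid. -/
def lenHom (n : ℕ) : BraidGroup n →* Multiplicative ℤ :=
  PresentedGroup.toGroup (f := fun _ => Multiplicative.ofAdd 1) (by
    rintro _ (⟨i, j, h⟩ | ⟨i, j, h⟩) <;> simp)

/-- The exponent sum of a braid, as an integer. -/
def len (X : BraidGroup n) : ℤ := (lenHom n X).toAdd

theorem len_mul (X Y : BraidGroup n) : len (X * Y) = len X + len Y := by
  simp [len]

theorem len_one : len (1 : BraidGroup n) = 0 := by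
  simp [len]

theorem len_inv (X : BraidGroup n) : len X⁻¹ = -len X := by
  simp [len]

theorem len_zpow (X : BraidGroup n) (p : ℤ) : len (X ^ p) = p * len X := by
  simp [len]

theorem len_gen (i : GenIndex n) : len (gen i) = 1 := by
  simp [len, lenHom, gen]

theorem len_eq_of_isConj {X Y : BraidGroup n} (h : IsConj X Y) : len X = len Y := by
  obtain ⟨c, rfl⟩ := isConj_iff.1 h
  simp [len_mul, len_inv]

theorem len_prod_gen (w : List (GenIndex n)) : len (w.map gen).prod = w.length := by
  induction w with
  | nil => simp [len_one]
  | cons i w ih => simp [len_mul, len_gen, ih, add_comm]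

theorem IsPositive.len_nonneg {X : BraidGroup n} (h : IsPositive X) : 0 ≤ len X := by
  unfold IsPositive at h
  induction h using Submonoid.closure_induction with
  | mem x hx => obtain ⟨i, rfl⟩ := hx; simp [len_gen]
  | one => simp [len_one]
  | mul x y _ _ hx hy => rw [len_mul]; omega

/-- The braid given by a positive word. -/
def wordProd (w : List (GenIndex n)) : BraidGroup n := (w.map gen).prod

theorem wordProd_nil : wordProd ([] : List (GenIndex n)) = 1 := rfl

theorem wordProd_cons (i : GenIndex n) (w : List (GenIndex n)) :
    wordProd (i :: w) = gen i * wordProd w := by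
  simp [wordProd]

theorem wordProd_append (w v : List (GenIndex n)) :
    wordProd (w ++ v) = wordProd w * wordProd v := by
  simp [wordProd]

theorem len_wordProd (w : List (GenIndex n)) : len (wordProd w) = w.length :=
  len_prod_gen w

theorem leftPos_lt_rightPos (i : GenIndex n) : leftPos i < rightPos i :=
  Nat.lt_succ_self (i : ℕ)

theorem genSwap_leftPos (i : GenIndex n) : genSwap i (leftPos i) = rightPos i :=
  Equiv.swap_apply_left _ _

theorem genSwap_rightPos (i : GenIndex n) : genSwap i (rightPos i) = leftPos i :=
  Equiv.swap_apply_right _ _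

theorem perm_wordProd_cons (i : GenIndex n) (w : List (GenIndex n)) (j : Puncture n) :
    perm (wordProd (i :: w)) j = perm (wordProd w) (genSwap i j) := by
  rw [wordProd_cons, perm_mul, perm_gen, Equiv.Perm.mul_apply]

theorem crossings_cons (i : GenIndex n) (w : List (GenIndex n)) (j k : Puncture n) :
    crossings (i :: w) j k =
      (if IsCrossing i j k then 1 else 0) + crossings w (genSwap i j) (genSwap i k) := by
  rw [crossings]
  congr 1

theorem IsCrossing.symm {i : GenIndex n} {j k : Puncture n} (h : IsCrossing i j k) :
    IsCrossing i k j :=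
  (Or.symm h).imp And.symm And.symm

theorem crossings_comm (w : List (GenIndex n)) (j k : Puncture n) :
    crossings w j k = crossings w k j := by
  induction w generalizing j k with
  | nil => rfl
  | cons i w ih =>
    rw [crossings_cons, crossings_cons, ih]
    simp only [show IsCrossing i j k ↔ IsCrossing i k j from ⟨IsCrossing.symm, IsCrossing.symm⟩]

theorem crossings_self (w : List (GenIndex n)) (j : Puncture n) : crossings w j j = 0 := by
  induction w generalizing j with
  | nil => rfl
  | cons i w ih =>
    rw [crossings_cons, ih, if_neg]
    rw [isCrossing_iff]
    omega

theorem crossings_append (w v : List (GenIndex n)) (j k : Puncture n) :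
    crossings (w ++ v) j k =
      crossings w j k + crossings v (perm (wordProd w) j) (perm (wordProd w) k) := by
  induction w generalizing j k with
  | nil => simp [crossings, wordProd_nil, perm_one]
  | cons i w ih =>
    rw [List.cons_append, crossings_cons, crossings_cons, ih, perm_wordProd_cons,
      perm_wordProd_cons, add_assoc]

theorem crossNum_wordProd (w : List (GenIndex n)) (j k : Puncture n) :
    crossNum (wordProd w) j k = crossings w j k := by
  induction w generalizing j k with
  | nil => simp [crossings, wordProd_nil, crossNum_one]
  | cons i w ih =>
    rw [crossings_cons, wordProd_cons, crossNum_mul, ih, crossNum_gen,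
      perm_gen]
    push_cast
    rfl

/-! ### Inversions and reduced words -/

/-- The permutation `f` reverses the order of `j` and `k`. -/
def Inverts (f : Equiv.Perm (Puncture n)) (j k : Puncture n) : Prop :=
  (j < k ∧ f k < f j) ∨ (k < j ∧ f j < f k)

instance (f : Equiv.Perm (Puncture n)) (j k : Puncture n) : Decidable (Inverts f j k) :=
  inferInstanceAs (Decidable (_ ∨ _))

theorem Inverts.symm {f : Equiv.Perm (Puncture n)} {j k : Puncture n} (h : Inverts f j k) :
    Inverts f k j :=
  Or.symm h

/-- The order of two points is reversed by a composite when exactly one factor reverses it; the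
negated equivalence is this exclusive or. -/
theorem inverts_mul_iff {f g : Equiv.Perm (Puncture n)} {j k : Puncture n} :
    Inverts (g * f) j k ↔ (Inverts f j k ↔ ¬ Inverts g (f j) (f k)) := by
  rcases lt_trichotomy j k with h | rfl | h
  · rcases lt_trichotomy (f j) (f k) with h' | h' | h'
    · rcases lt_trichotomy (g (f j)) (g (f k)) with h3 | h3 | h3 <;>
      simp [Inverts, h, h', h3, h.not_gt, h'.not_gt, h3.not_gt]
    · exact absurd (f.injective h') h.ne
    · rcases lt_trichotomy (g (f j)) (g (f k)) with h3 | h3 | h3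
      · simp [Inverts, h, h', h3, h.not_gt, h'.not_gt, h3.not_gt]
      · exact absurd (g.injective h3) h'.ne'
      · simp [Inverts, h, h', h3, h.not_gt, h'.not_gt, h3.not_gt]
  · simp [Inverts]
  · rcases lt_trichotomy (f j) (f k) with h' | h' | h'
    · rcases lt_trichotomy (g (f j)) (g (f k)) with h3 | h3 | h3
      · simp [Inverts, h, h', h3, h.not_gt, h'.not_gt, h3.not_gt]
      · exact absurd (g.injective h3) h'.ne
      · simp [Inverts, h, h', h3, h.not_gt, h'.not_gt, h3.not_gt]
    · exact absurd (f.injective h') h.ne'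
    · rcases lt_trichotomy (g (f j)) (g (f k)) with h3 | h3 | h3 <;>
      simp [Inverts, h, h', h3, h.not_gt, h'.not_gt, h3.not_gt]

theorem inverts_genSwap_iff (i : GenIndex n) (j k : Puncture n) :
    Inverts (genSwap i) j k ↔ IsCrossing i j k := by
  simp only [Inverts, isCrossing_iff, ← Subtype.coe_lt_coe, genSwap_coe]
  split_ifs <;> omega

theorem odd_crossings_iff (w : List (GenIndex n)) (j k : Puncture n) :
    Odd (crossings w j k) ↔ Inverts (perm (wordProd w)) j k := by
  induction w generalizing j k with
  | nil =>
    simp only [crossings, wordProd_nil, perm_one, Inverts, Equiv.Perm.one_apply]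
    refine iff_of_false (by decide) ?_
    rintro (⟨h, h'⟩ | ⟨h, h'⟩) <;> exact lt_asymm h h'
  | cons i w ih =>
    rw [crossings_cons, wordProd_cons, perm_mul, inverts_mul_iff, perm_gen, inverts_genSwap_iff,
      ← ih, Nat.odd_add, Nat.not_odd_iff_even]
    split_ifs with h <;> simp [h]

/-- A positive word is reduced if any two strands cross at most once. -/
def IsReduced (w : List (GenIndex n)) : Prop :=
  ∀ j k : Puncture n, j ≠ k → crossings w j k ≤ 1

theorem IsReduced.crossings_eq {w : List (GenIndex n)} (h : IsReduced w) (j k : Puncture n) :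
    crossings w j k = if Inverts (perm (wordProd w)) j k then 1 else 0 := by
  rcases eq_or_ne j k with rfl | hjk
  · simp [crossings_self, Inverts]
  · have h1 := odd_crossings_iff w j k
    have h2 := h j k hjk
    interval_cases crossings w j k
    · rw [if_neg (h1.not.1 (by decide))]
    · rw [if_pos (h1.1 (by decide))]

/-- A leading `σ_i` adds one crossing to a single pair of strands. The new word stays reduced
exactly when these two do not cross later. -/
theorem isReduced_cons {i : GenIndex n} {w : List (GenIndex n)} :
    IsReduced (i :: w) ↔
      IsReduced w ∧ perm (wordProd w) (leftPos i) < perm (wordProd w) (rightPos i) := by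
  have hlr := leftPos_lt_rightPos i
  constructor
  · intro h
    have hw : IsReduced w := fun j k hjk => by
      have := h (genSwap i j) (genSwap i k) ((genSwap i).injective.ne hjk)
      rw [crossings_cons, genSwap_genSwap, genSwap_genSwap] at this
      omega
    refine ⟨hw, ?_⟩
    have := h _ _ hlr.ne'
    rw [crossings_cons, genSwap_leftPos, genSwap_rightPos, hw.crossings_eq,
      if_pos (show IsCrossing i (rightPos i) (leftPos i) from Or.inr ⟨rfl, rfl⟩)] at this
    by_contra! hle
    have hinv : Inverts (perm (wordProd w)) (leftPos i) (rightPos i) :=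
      Or.inl ⟨hlr, hle.lt_of_ne ((perm (wordProd w)).injective.ne hlr.ne')⟩
    rw [if_pos hinv] at this
    omega
  · rintro ⟨hw, hlt⟩ j k hjk
    rw [crossings_cons]
    have h1 := hw _ _ ((genSwap i).injective.ne hjk)
    split_ifs with hc
    · have h0 : crossings w (leftPos i) (rightPos i) = 0 := by
        rw [hw.crossings_eq, if_neg]
        rintro (⟨_, h⟩ | ⟨h, _⟩)
        · exact lt_asymm h hlt
        · exact lt_asymm h hlr
      rcases hc with ⟨rfl, rfl⟩ | ⟨rfl, rfl⟩
      · rw [genSwap_leftPos, genSwap_rightPos, crossings_comm, h0]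
      · rw [genSwap_leftPos, genSwap_rightPos, h0]
    · omega

/-! ### Reduced words of a permutation and Matsumoto's theorem -/

theorem isReduced_nil : IsReduced ([] : List (GenIndex n)) := fun _ _ _ => Nat.zero_le 1

/-- Both permutations have the same sum of values, so no inequality can be strict. -/
theorem perm_eq_of_forall_le {f g : Equiv.Perm (Puncture n)} (h : ∀ x, f x ≤ g x) : f = g := by
  have hs : ∑ x, (f x : ℕ) = ∑ x, (g x : ℕ) := by
    rw [Equiv.sum_comp f (fun x => (x : ℕ)), Equiv.sum_comp g (fun x => (x : ℕ))]
  have := (Finset.sum_eq_sum_iff_of_le (fun x _ => Subtype.coe_le_coe.2 (h x))).1 hs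
  ext x
  exact this x (Finset.mem_univ x)

/-- A permutation without descents is the identity. -/
theorem eq_one_of_forall_lt {f : Equiv.Perm (Puncture n)}
    (h : ∀ i : GenIndex n, f (leftPos i) < f (rightPos i)) : f = 1 := by
  refine (perm_eq_of_forall_le fun x => ?_).symm
  have key (m : ℕ) : ∀ h1 : 1 ≤ m, ∀ h2 : m ≤ n, m ≤ (f ⟨m, h1, h2⟩ : ℕ) := by
    induction m with
    | zero => intro h1; omega
    | succ m ih =>
      intro h1 h2
      rcases Nat.eq_zero_or_pos m with rfl | hm
      · exact (f _).2.1
      · have a := ih hm (by omega)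
        have b := h ⟨m, hm, h2⟩
        exact lt_of_le_of_lt a b
  exact key x x.2.1 x.2.2

/-- Bubble sort: a descent is split off as the first letter. The weights `n - x` decrease with the
position, so moving the smaller value to the left lowers the weighted sum. -/
theorem exists_isReduced (f : Equiv.Perm (Puncture n)) :
    ∃ w : List (GenIndex n), IsReduced w ∧ perm (wordProd w) = f := by
  induction hm : ∑ x : Puncture n, (n - (x : ℕ)) * (f x : ℕ) using Nat.strong_induction_on
    generalizing f with
  | _ m ih =>
    by_cases hf : ∀ i : GenIndex n, f (leftPos i) < f (rightPos i)
    · exact ⟨[], isReduced_nil, by rw [wordProd_nil, perm_one, eq_one_of_forall_lt hf]⟩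
    · push Not at hf
      obtain ⟨i, hi⟩ := hf
      have hlr := leftPos_lt_rightPos i
      have hi : f (rightPos i) < f (leftPos i) := hi.lt_of_ne (f.injective.ne hlr.ne')
      obtain ⟨w, hw, hwf⟩ := ih (∑ x : Puncture n, (n - (x : ℕ)) * ((f * genSwap i) x : ℕ)) (by
        rw [← hm]
        rw [← Finset.sum_erase_add _ _ (Finset.mem_univ (leftPos i)),
          ← Finset.sum_erase_add _ _ (Finset.mem_univ (leftPos i)),
          ← Finset.sum_erase_add _ _ (Finset.mem_erase.2 ⟨hlr.ne', Finset.mem_univ (rightPos i)⟩),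
          ← Finset.sum_erase_add _ _ (Finset.mem_erase.2 ⟨hlr.ne', Finset.mem_univ (rightPos i)⟩)]
        have : ∀ x ∈ ((Finset.univ.erase (leftPos i)).erase (rightPos i)),
            (n - (x : ℕ)) * ((f * genSwap i) x : ℕ) = (n - (x : ℕ)) * (f x : ℕ) := by
          intro x hx
          simp only [Finset.mem_erase] at hx
          rw [Equiv.Perm.mul_apply, genSwap, Equiv.swap_apply_of_ne_of_ne hx.2.1 hx.1]
        rw [Finset.sum_congr rfl this, Equiv.Perm.mul_apply, Equiv.Perm.mul_apply,
          genSwap_leftPos, genSwap_rightPos, add_assoc, add_assoc]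
        refine Nat.add_lt_add_left ?_ _
        obtain ⟨c, hc⟩ : ∃ c, n - (i : ℕ) = c + 1 := ⟨n - i - 1, by have := i.2.2; omega⟩
        have hc' : n - ((i : ℕ) + 1) = c := by omega
        have hi' : (f (rightPos i) : ℕ) < f (leftPos i) := hi
        simp only [leftPos, rightPos, hc, hc'] at hi' ⊢
        nlinarith) (f * genSwap i) rfl
      refine ⟨i :: w, isReduced_cons.2 ⟨hw, ?_⟩, ?_⟩
      · rw [hwf]
        simpa [genSwap_leftPos, genSwap_rightPos] using hi
      · ext1 x
        rw [perm_wordProd_cons, hwf, Equiv.Perm.mul_apply, genSwap_genSwap]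

theorem gen_comm (i j : GenIndex n) (h : (i : ℕ) + 1 < j ∨ (j : ℕ) + 1 < i) :
    gen i * gen j = gen j * gen i := by
  have := PresentedGroup.one_of_mem (rels := {w | Relator n w}) (Relator.comm i j h)
  rw [map_mul, map_inv, mul_inv_eq_one, map_mul, map_mul] at this
  exact this

theorem gen_braid (i j : GenIndex n) (h : (j : ℕ) = i + 1 ∨ (i : ℕ) = j + 1) :
    gen i * gen j * gen i = gen j * gen i * gen j := by
  have := PresentedGroup.one_of_mem (rels := {w | Relator n w}) (Relator.braid i j h)
  rw [map_mul, map_inv, mul_inv_eq_one] at this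
  simp only [map_mul] at this
  exact this

/-- If `f` has descents at `i` and `j`, it has reduced words starting with either side of the
commutation or braid relation between `σ_i` and `σ_j`, followed by a common reduced word `z`. This
is the local step of Matsumoto's theorem. -/
theorem exists_reduced_continuations {f : Equiv.Perm (Puncture n)} {i j : GenIndex n}
    (hij : i ≠ j) (hi : f (rightPos i) < f (leftPos i)) (hj : f (rightPos j) < f (leftPos j)) :
    ∃ x y : List (GenIndex n), IsReduced x ∧ IsReduced y ∧ perm (wordProd x) = f * genSwap i ∧
      perm (wordProd y) = f * genSwap j ∧ wordProd (i :: x) = wordProd (j :: y) := by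
  by_cases hfar : (i : ℕ) + 1 < j ∨ (j : ℕ) + 1 < i
  · obtain ⟨z, hz, hzf⟩ := exists_isReduced (f * genSwap i * genSwap j)
    have hc := genSwap_comm i j hfar
    have e1 : genSwap i (leftPos j) = leftPos j ∧ genSwap i (rightPos j) = rightPos j ∧
        genSwap j (leftPos i) = leftPos i ∧ genSwap j (rightPos i) = rightPos i := by
      simp only [Subtype.ext_iff, genSwap_coe, leftPos, rightPos]
      refine ⟨?_, ?_, ?_, ?_⟩ <;> split_ifs <;> omega
    obtain ⟨e1, e2, e3, e4⟩ := e1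
    refine ⟨j :: z, i :: z, isReduced_cons.2 ⟨hz, ?_⟩, isReduced_cons.2 ⟨hz, ?_⟩, ?_, ?_, ?_⟩
    · simpa [hzf, genSwap_leftPos, genSwap_rightPos, e1, e2] using hj
    · rw [mul_assoc, hc, ← mul_assoc] at hzf
      simpa [hzf, genSwap_leftPos, genSwap_rightPos, e3, e4] using hi
    · ext1 x
      simp [perm_wordProd_cons, hzf, genSwap_genSwap]
    · rw [mul_assoc, hc, ← mul_assoc] at hzf
      ext1 x
      simp [perm_wordProd_cons, hzf, genSwap_genSwap]
    · simp only [wordProd_cons, ← mul_assoc, gen_comm i j hfar]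
  · have hadj : (j : ℕ) = i + 1 ∨ (i : ℕ) = j + 1 := by
      have : (i : ℕ) ≠ j := fun h => hij (Subtype.ext h)
      omega
    obtain ⟨z, hz, hzf⟩ := exists_isReduced (f * genSwap i * genSwap j * genSwap i)
    have hc := genSwap_braid i j hadj
    have hzf' : perm (wordProd z) = f * genSwap j * genSwap i * genSwap j := by
      rw [hzf, mul_assoc, mul_assoc, ← mul_assoc (genSwap i), hc]
      simp only [mul_assoc]
    have main : ∀ i j : GenIndex n, i ≠ j → (j : ℕ) = i + 1 ∨ (i : ℕ) = j + 1 →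
        f (rightPos i) < f (leftPos i) → f (rightPos j) < f (leftPos j) →
        perm (wordProd z) = f * genSwap i * genSwap j * genSwap i →
        IsReduced (j :: i :: z) ∧ perm (wordProd (j :: i :: z)) = f * genSwap i := by
      intro i j hij hadj hi hj hzf
      refine ⟨isReduced_cons.2 ⟨isReduced_cons.2 ⟨hz, ?_⟩, ?_⟩, ?_⟩
      · have e1 : genSwap i (genSwap j (rightPos i)) = rightPos j ∧
            genSwap i (genSwap j (leftPos i)) = leftPos j := by
          simp only [Subtype.ext_iff, genSwap_coe, leftPos, rightPos]
          refine ⟨?_, ?_⟩ <;> split_ifs <;> omega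
        simpa [hzf, genSwap_leftPos, genSwap_rightPos, e1] using hj
      · simp only [perm_wordProd_cons, hzf, Equiv.Perm.mul_apply, genSwap_genSwap,
          genSwap_leftPos, genSwap_rightPos]
        rcases hadj with h | h
        · have e1 : genSwap i (rightPos j) = rightPos j ∧
              genSwap i (leftPos j) = leftPos i ∧ leftPos j = rightPos i := by
            simp only [Subtype.ext_iff, genSwap_coe, leftPos, rightPos]
            refine ⟨?_, ?_, ?_⟩ <;> (try split_ifs) <;> omega
          obtain ⟨e1, e2, e3⟩ := e1
          rw [e1, e2]
          rw [e3] at hj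
          exact hj.trans hi
        · have e1 : genSwap i (leftPos j) = leftPos j ∧
              genSwap i (rightPos j) = rightPos i ∧ rightPos j = leftPos i := by
            simp only [Subtype.ext_iff, genSwap_coe, leftPos, rightPos]
            refine ⟨?_, ?_, ?_⟩ <;> (try split_ifs) <;> omega
          obtain ⟨e1, e2, e3⟩ := e1
          rw [e1, e2]
          rw [e3] at hj
          exact hi.trans hj
      · ext1 x
        simp [perm_wordProd_cons, hzf, genSwap_genSwap]
    obtain ⟨a1, a2⟩ := main i j hij hadj hi hj hzf
    obtain ⟨b1, b2⟩ := main j i hij.symm hadj.symm hj hi hzf'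
    refine ⟨_, _, a1, b1, a2, b2, ?_⟩
    simp only [wordProd_cons, ← mul_assoc, gen_braid i j hadj]

/-- Matsumoto's theorem: reduced words with the same permutation give the same braid. -/
theorem IsReduced.wordProd_eq {w v : List (GenIndex n)} (hw : IsReduced w) (hv : IsReduced v)
    (h : perm (wordProd w) = perm (wordProd v)) : wordProd w = wordProd v := by
  induction hm : w.length generalizing w v with
  | zero =>
    obtain rfl := List.eq_nil_of_length_eq_zero hm
    cases v with
    | nil => rfl
    | cons j v =>
      have h1 := (isReduced_cons.1 hv).2
      rw [wordProd_nil, perm_one] at h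
      have hl := perm_wordProd_cons j v (leftPos j)
      have hr := perm_wordProd_cons j v (rightPos j)
      rw [← h, genSwap_leftPos, Equiv.Perm.one_apply] at hl
      rw [← h, genSwap_rightPos, Equiv.Perm.one_apply] at hr
      rw [← hl, ← hr] at h1
      exact absurd h1 (leftPos_lt_rightPos j).not_gt
  | succ m ih =>
    have desc : ∀ {i : GenIndex n} {w : List (GenIndex n)}, IsReduced (i :: w) →
        perm (wordProd (i :: w)) (rightPos i) < perm (wordProd (i :: w)) (leftPos i) ∧
          perm (wordProd w) = perm (wordProd (i :: w)) * genSwap i := by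
      intro i w h
      refine ⟨?_, ?_⟩
      · rw [perm_wordProd_cons, perm_wordProd_cons, genSwap_leftPos, genSwap_rightPos]
        exact (isReduced_cons.1 h).2
      · ext1 x
        rw [Equiv.Perm.mul_apply, perm_wordProd_cons, genSwap_genSwap]
    obtain _ | ⟨i, w⟩ := w
    · simp at hm
    have hm : w.length = m := by simpa using hm
    have hw' := (isReduced_cons.1 hw).1
    obtain ⟨di, ei⟩ := desc hw
    obtain _ | ⟨j, v⟩ := v
    · rw [h, wordProd_nil, perm_one] at di
      exact absurd di (leftPos_lt_rightPos i).not_gt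
    have hv' := (isReduced_cons.1 hv).1
    obtain ⟨dj, ej⟩ := desc hv
    rw [← h] at dj ej
    rcases eq_or_ne i j with rfl | hij
    · rw [wordProd_cons, wordProd_cons, ih hw' hv' (ei.trans ej.symm) hm]
    · obtain ⟨x, y, hx, hy, hxf, hyf, hxy⟩ := exists_reduced_continuations hij di dj
      have hwx := ih hw' hx (ei.trans hxf.symm) hm
      -- The chain is `i w = i x = j y = j v`. The induction hypothesis applies to `y` and `v` only
      -- once `y` is known to have length `m`, which the exponent sum gives.
      have hyl : y.length = m := by
        have h1 := congrArg len hxy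
        have h2 := congrArg len hwx
        simp only [len_wordProd, List.length_cons] at h1 h2
        omega
      have hyv := ih hy hv' (hyf.trans ej.symm) hyl
      rw [wordProd_cons, hwx, ← wordProd_cons, hxy, wordProd_cons, hyv, ← wordProd_cons]

/-! ### Simple braids -/

theorem isSimple_iff {X : BraidGroup n} : IsSimple X ↔ ∃ w, IsReduced w ∧ wordProd w = X := by
  simp only [IsSimple, IsReduced, wordProd, and_comm]

theorem IsSimple.eq_of_perm_eq {X Y : BraidGroup n} (hX : IsSimple X) (hY : IsSimple Y)
    (h : perm X = perm Y) : X = Y := by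
  obtain ⟨w, hw, rfl⟩ := isSimple_iff.1 hX
  obtain ⟨v, hv, rfl⟩ := isSimple_iff.1 hY
  exact hw.wordProd_eq hv h

theorem exists_isSimple (f : Equiv.Perm (Puncture n)) :
    ∃ X : BraidGroup n, IsSimple X ∧ perm X = f := by
  obtain ⟨w, hw, hf⟩ := exists_isReduced f
  exact ⟨_, isSimple_iff.2 ⟨w, hw, rfl⟩, hf⟩

theorem IsSimple.crossNum_eq {X : BraidGroup n} (hX : IsSimple X) (j k : Puncture n) :
    crossNum X j k = if Inverts (perm X) j k then 1 else 0 := by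
  obtain ⟨w, hw, rfl⟩ := isSimple_iff.1 hX
  rw [crossNum_wordProd, hw.crossings_eq]
  split_ifs <;> rfl

theorem isSimple_one : IsSimple (1 : BraidGroup n) :=
  isSimple_iff.2 ⟨[], isReduced_nil, rfl⟩

theorem IsSimple.mul {X Y : BraidGroup n} (hX : IsSimple X) (hY : IsSimple Y)
    (h : ∀ j k, Inverts (perm X) j k → ¬ Inverts (perm Y) (perm X j) (perm X k)) :
    IsSimple (X * Y) := by
  obtain ⟨w, hw, rfl⟩ := isSimple_iff.1 hX
  obtain ⟨v, hv, rfl⟩ := isSimple_iff.1 hY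
  refine isSimple_iff.2 ⟨w ++ v, fun j k _ => ?_, wordProd_append w v⟩
  rw [crossings_append, hw.crossings_eq, hv.crossings_eq]
  split_ifs with h1 h2
  · exact absurd h2 (h j k h1)
  all_goals simp

theorem IsSimple.gen_mul {i : GenIndex n} {X : BraidGroup n} (hX : IsSimple X)
    (h : perm X (leftPos i) < perm X (rightPos i)) : IsSimple (gen i * X) := by
  obtain ⟨w, hw, rfl⟩ := isSimple_iff.1 hX
  exact isSimple_iff.2 ⟨i :: w, isReduced_cons.2 ⟨hw, h⟩, wordProd_cons i w⟩

theorem IsSimple.len_nonneg {X : BraidGroup n} (hX : IsSimple X) : 0 ≤ len X := by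
  obtain ⟨w, hw, rfl⟩ := isSimple_iff.1 hX
  rw [len_wordProd]
  positivity

theorem IsSimple.len_pos {X : BraidGroup n} (hX : IsSimple X) (h : X ≠ 1) : 0 < len X := by
  obtain ⟨w, hw, rfl⟩ := isSimple_iff.1 hX
  rw [len_wordProd]
  cases w with
  | nil => exact absurd wordProd_nil h
  | cons i w => simp

/-- Each letter crosses one pair of strands, counted twice because the pairs are ordered. -/
theorem sum_crossings (w : List (GenIndex n)) :
    ∑ p : Puncture n × Puncture n, crossings w p.1 p.2 = 2 * w.length := by
  induction w with
  | nil => simp [crossings]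
  | cons i w ih =>
    simp only [crossings_cons, Finset.sum_add_distrib, List.length_cons]
    have hs : ∑ p : Puncture n × Puncture n, crossings w (genSwap i p.1) (genSwap i p.2) =
        ∑ p : Puncture n × Puncture n, crossings w p.1 p.2 :=
      Equiv.sum_comp ((genSwap i).prodCongr (genSwap i))
        (fun p : Puncture n × Puncture n => crossings w p.1 p.2)
    rw [← Finset.card_filter, hs, ih]
    have : (Finset.univ.filter fun p : Puncture n × Puncture n => IsCrossing i p.1 p.2) =
        {(leftPos i, rightPos i), (rightPos i, leftPos i)} := by
      ext ⟨a, b⟩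
      rw [Finset.mem_filter]
      simp [IsCrossing]
    rw [this, Finset.card_pair]
    · ring
    · simp [(leftPos_lt_rightPos i).ne]

theorem IsSimple.two_mul_len_le {X : BraidGroup n} (hX : IsSimple X) :
    2 * len X ≤ n * (n - 1) := by
  obtain ⟨w, hw, rfl⟩ := isSimple_iff.1 hX
  have h : ∑ p : Puncture n × Puncture n, crossings w p.1 p.2 ≤
      ∑ p : Puncture n × Puncture n, if p ∈ Finset.univ.offDiag then 1 else 0 := by
    refine Finset.sum_le_sum fun p _ => ?_
    split_ifs with hp
    · exact hw _ _ (by simpa using hp)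
    · rw [show p.1 = p.2 by simpa using hp, crossings_self]
  rw [sum_crossings, ← Finset.card_filter, Finset.filter_mem_eq_inter, Finset.univ_inter,
    Finset.offDiag_card, Finset.card_univ, show Fintype.card (Puncture n) = n by simp,
    ← Nat.mul_sub_one] at h
  rw [len_wordProd]
  rcases n with _ | n
  · have : w = [] := by simpa using h
    simp [this]
  · push_cast
    simp only [Nat.add_sub_cancel] at h
    simp only [add_sub_cancel_right]
    exact_mod_cast h

/-! ### Permutations and exponent sums of the special braids -/

theorem sigmaDown_self (i : ℕ) : sigmaDown n i i = 1 := by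
  simp [sigmaDown]

theorem sigmaDown_succ {i j : ℕ} (h : i ≤ j) :
    sigmaDown n (j + 1) i = sigma n j * sigmaDown n j i := by
  rw [sigmaDown, Nat.succ_sub h, List.range'_1_concat, Nat.add_sub_cancel' h]
  simp [sigmaDown]

theorem exists_sigma_eq_gen {i : ℕ} (h : 1 ≤ i) (h' : i < n) :
    ∃ g : GenIndex n, (g : ℕ) = i ∧ sigma n i = gen g :=
  ⟨⟨i, h, h'⟩, rfl, dif_pos _⟩

theorem len_sigma {i : ℕ} (h : 1 ≤ i) (h' : i < n) : len (sigma n i) = 1 := by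
  obtain ⟨g, -, hg⟩ := exists_sigma_eq_gen h h'
  rw [hg, len_gen]

theorem coe_leftPos (i : GenIndex n) : (leftPos i : ℕ) = i := rfl

theorem coe_rightPos (i : GenIndex n) : (rightPos i : ℕ) = i + 1 := rfl

theorem isSimple_sigmaDown_and_perm {i j : ℕ} (hi : 1 ≤ i) (hij : i ≤ j) (hj : j ≤ n) :
    IsSimple (sigmaDown n j i) ∧ ∀ x : Puncture n, (perm (sigmaDown n j i) x : ℕ) =
      if (x : ℕ) = j then i else if i ≤ (x : ℕ) ∧ (x : ℕ) < j then x + 1 else x := by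
  induction j, hij using Nat.le_induction with
  | base =>
    rw [sigmaDown_self]
    refine ⟨isSimple_one, fun x => ?_⟩
    rw [perm_one, Equiv.Perm.one_apply]
    split_ifs <;> omega
  | succ j hij ih =>
    obtain ⟨hs, hp⟩ := ih (by omega)
    obtain ⟨g, hg, hσ⟩ := exists_sigma_eq_gen (n := n) (i := j) (by omega) (by omega)
    rw [sigmaDown_succ hij, hσ]
    refine ⟨hs.gen_mul ?_, fun x => ?_⟩
    · rw [← Subtype.coe_lt_coe, hp, hp]
      rw [coe_leftPos, coe_rightPos, if_pos hg, if_neg (by omega), if_neg (by omega)]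
      omega
    · rw [perm_mul, Equiv.Perm.mul_apply, hp, perm_gen, genSwap_coe]
      split_ifs <;> omega

theorem isSimple_sigmaDown {i j : ℕ} (hi : 1 ≤ i) (hij : i ≤ j) (hj : j ≤ n) :
    IsSimple (sigmaDown n j i) :=
  (isSimple_sigmaDown_and_perm hi hij hj).1

theorem perm_sigmaDown {i j : ℕ} (hi : 1 ≤ i) (hij : i ≤ j) (hj : j ≤ n) (x : Puncture n) :
    (perm (sigmaDown n j i) x : ℕ) =
      if (x : ℕ) = j then i else if i ≤ (x : ℕ) ∧ (x : ℕ) < j then x + 1 else x :=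
  (isSimple_sigmaDown_and_perm hi hij hj).2 x

theorem len_sigmaDown {i j : ℕ} (hi : 1 ≤ i) (hij : i ≤ j) (hj : j ≤ n) :
    len (sigmaDown n j i) = j - i := by
  induction j, hij using Nat.le_induction with
  | base => rw [sigmaDown_self, len_one, sub_self]
  | succ j hij ih =>
    rw [sigmaDown_succ hij, len_mul, len_sigma (by omega) (by omega), ih (by omega)]
    push_cast
    ring

theorem isSimple_epsilon (hn : 3 ≤ n) : IsSimple (epsilon n) := by
  obtain ⟨g, hg, hσ⟩ := exists_sigma_eq_gen (n := n) (i := 1) le_rfl (by omega)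
  rw [epsilon, hσ]
  refine (isSimple_sigmaDown le_rfl (by omega) le_rfl).gen_mul ?_
  rw [← Subtype.coe_lt_coe, perm_sigmaDown le_rfl (by omega) le_rfl,
    perm_sigmaDown le_rfl (by omega) le_rfl]
  rw [coe_leftPos, coe_rightPos, if_neg (by omega), if_pos (by omega)]
  split_ifs <;> omega

theorem perm_epsilon (hn : 3 ≤ n) (x : Puncture n) : (perm (epsilon n) x : ℕ) =
    if (x : ℕ) = n then 1 else if (x : ℕ) = 1 then 3 else
      if (x : ℕ) = 2 then 2 else (x : ℕ) + 1 := by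
  have := x.2.1
  have := x.2.2
  obtain ⟨g, hg, hσ⟩ := exists_sigma_eq_gen (n := n) (i := 1) le_rfl (by omega)
  rw [epsilon, hσ, perm_mul, Equiv.Perm.mul_apply,
    perm_sigmaDown le_rfl (by omega) le_rfl, perm_gen, genSwap_coe]
  split_ifs <;> omega

theorem len_epsilon (hn : 3 ≤ n) : len (epsilon n) = n := by
  rw [epsilon, len_mul, len_sigma (by omega) (by omega),
    len_sigmaDown le_rfl (by omega) le_rfl]
  push_cast
  ring

theorem two_mul_len_Delta (hn : 1 ≤ n) : 2 * len (Delta n) = n * (n - 1) := by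
  have key (m : ℕ) : m + 1 ≤ n →
      2 * len ((List.range m).map fun k => sigmaDown n (k + 2) 1).prod = (m + 1) * m := by
    induction m with
    | zero => simp [len_one]
    | succ m ih =>
      intro hm
      rw [List.range_succ, List.map_append, List.prod_append, len_mul, mul_add, ih (by omega),
        List.map_singleton, List.prod_singleton, len_sigmaDown le_rfl (by omega) (by omega)]
      push_cast
      ring
  have := key (n - 1) (by omega)
  rw [Delta, this]
  push_cast [hn]
  ring

theorem Delta_three : Delta 3 = epsilon 3 := by
  simp [Delta, epsilon, List.range_succ, sigmaDown_succ (n := 3) (le_refl 1), sigmaDown_self]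

/-! ### Normal forms, and the ultra summit set as the set of simple conjugates -/

theorem isPositive_one : IsPositive (1 : BraidGroup n) := Submonoid.one_mem _

theorem isLeftNormalForm_nil (hn : 3 ≤ n) (p : ℤ) : IsLeftNormalForm (Delta n ^ p) p [] where
  eq_prod := by simp
  max_exponent q hq := by
    have h := hq.len_nonneg
    have hD := two_mul_len_Delta (n := n) (by omega)
    rw [len_mul, len_inv, len_zpow, len_zpow] at h
    have hpos : 0 < len (Delta n) := by
      have : (3 : ℤ) ≤ n := by exact_mod_cast hn
      nlinarith
    nlinarith
  ne_one := by simp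
  isMaxSimplePrefix := by simp

/-- An exponent sum below that of `Δ` rules out every positive power of `Δ` as a prefix, and a
simple braid is its own maximal simple prefix. -/
theorem IsSimple.isLeftNormalForm (hn : 1 ≤ n) {X : BraidGroup n} (hX : IsSimple X) (h1 : X ≠ 1)
    (hlt : 2 * len X < n * (n - 1)) : IsLeftNormalForm X 0 [X] where
  eq_prod := by simp
  max_exponent q hq := by
    have h := hq.len_nonneg
    have hD := two_mul_len_Delta hn
    have h0 := hX.len_nonneg
    rw [len_mul, len_inv, len_zpow] at h
    by_contra! hq
    nlinarith
  ne_one := by simpa using h1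
  isMaxSimplePrefix l₁ x l₂ h := by
    obtain ⟨rfl, rfl, rfl⟩ : l₁ = [] ∧ x = X ∧ l₂ = [] := by
      cases l₁ <;> simp_all
    refine ⟨hX, by simpa [IsPrefix] using isPositive_one, fun y _ hy => by simpa using hy⟩

theorem exists_hasCanonicalLength_epsilon (hn : 3 ≤ n) :
    ∃ r ≤ 1, HasCanonicalLength (epsilon n) r := by
  rcases hn.eq_or_lt with rfl | hn'
  · refine ⟨0, zero_le_one, 1, [], ?_, rfl⟩
    rw [← Delta_three]
    simpa using isLeftNormalForm_nil le_rfl 1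
  · refine ⟨1, le_rfl, 0, _, (isSimple_epsilon hn).isLeftNormalForm (by omega) ?_ ?_, rfl⟩
    · intro h
      have := len_epsilon hn
      rw [h, len_one] at this
      omega
    · rw [len_epsilon hn]
      have : (4 : ℤ) ≤ n := by exact_mod_cast hn'
      nlinarith

/-- Comparison with `ε` gives canonical length at most `1`, and the exponent sum `n` then determines
the power of `Δ`. -/
theorem isSimple_of_mem_USS_epsilon (hn : 3 ≤ n) {s : BraidGroup n} (hs : s ∈ USS (epsilon n)) :
    IsSimple s := by
  obtain ⟨hc, ⟨r, ⟨p, ys, hnf, rfl⟩, hmin⟩, -⟩ := hs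
  obtain ⟨r', hr', hε⟩ := exists_hasCanonicalLength_epsilon hn
  have hlen := (hmin _ _ (IsConj.refl _) hε).trans hr'
  have hn' : (3 : ℤ) ≤ n := by exact_mod_cast hn
  have hl : len s = n := by rw [← len_eq_of_isConj hc, len_epsilon hn]
  have hD := two_mul_len_Delta (n := n) (by omega)
  have hs := hnf.eq_prod
  match ys, hnf, hlen with
  | [], hnf, _ =>
    rw [List.prod_nil, mul_one] at hs
    rw [hs, len_zpow] at hl
    -- From `p · n(n-1)/2 = n`; the only solution with `n ≥ 3` is `n = 3`, `p = 1`.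
    have hp : p * (n - 1) = 2 := by
      have : (n : ℤ) * (p * (n - 1)) = n * 2 := by linear_combination 2 * hl - p * hD
      exact mul_left_cancel₀ (by omega) this
    have hp0 : 0 < p := by nlinarith
    have h3 : n = 3 := by
      have : (n : ℤ) ≤ 3 := by nlinarith
      omega
    subst h3
    have : p = 1 := by norm_num at hp; omega
    rw [hs, this, zpow_one, Delta_three]
    exact isSimple_epsilon hn
  | [y], hnf, _ =>
    have hy : IsSimple y := (hnf.isMaxSimplePrefix [] y [] rfl).isSimple
    have hpos := hy.len_pos (hnf.ne_one y (by simp))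
    have hle := hy.two_mul_len_le
    rw [List.prod_singleton] at hs
    rw [hs, len_mul, len_zpow] at hl
    -- Since `0 < len y ≤ len Δ` and `n ≤ len Δ`, a positive `p` leaves nothing for `y`, and a
    -- negative `p` requires `y` to be longer than `Δ`.
    have hp : p = 0 := by
      have e : p * (n * (n - 1)) + 2 * len y = 2 * n := by linear_combination 2 * hl - p * hD
      have hN : 2 * (n : ℤ) ≤ n * (n - 1) := by nlinarith
      rcases lt_trichotomy p 0 with h | h | h
      · nlinarith
      · exact h
      · nlinarith
    rw [hs, hp, zpow_zero, one_mul]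
    exact hy
  | _ :: _ :: _, _, h => simp at h

/-- For `n ≥ 4` the exponent `p` is `0` and `s` is the only factor, so cycling moves `s` past
nothing. Canonical length `0` would need `p (n - 1) = 2`, which is impossible. For `n = 3` the braid
is `Δ`, of canonical length `0`. -/
theorem IsSimple.mem_USS_epsilon (hn : 3 ≤ n) {s : BraidGroup n} (hs : IsSimple s)
    (hc : IsConj (epsilon n) s) (h3 : n = 3 → s = epsilon n) : s ∈ USS (epsilon n) := by
  rcases hn.eq_or_lt with rfl | hn'
  · have hnf : IsLeftNormalForm s 1 [] := by
      rw [h3 rfl, ← Delta_three]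
      simpa using isLeftNormalForm_nil le_rfl 1
    exact ⟨hc, ⟨0, ⟨_, _, hnf, rfl⟩, fun _ _ _ _ => Nat.zero_le _⟩,
      .single (IsCycling.nil _ _ hnf)⟩
  · have hl : len s = n := by rw [← len_eq_of_isConj hc, len_epsilon hn]
    have hn4 : (4 : ℤ) ≤ n := by exact_mod_cast hn'
    have hnf : IsLeftNormalForm s 0 [s] := by
      refine hs.isLeftNormalForm (by omega) ?_ ?_
      · rintro rfl
        rw [len_one] at hl
        omega
      · rw [hl]
        nlinarith
    refine ⟨hc, ⟨1, ⟨_, _, hnf, rfl⟩, ?_⟩, .single ?_⟩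
    · rintro Z r' hZ ⟨p, ys, hZnf, rfl⟩
      by_contra! hlt
      obtain rfl : ys = [] := List.eq_nil_of_length_eq_zero (by omega)
      have hD := two_mul_len_Delta (n := n) (by omega)
      have hlZ : len Z = n := by rw [← len_eq_of_isConj hZ, len_epsilon hn]
      rw [hZnf.eq_prod, List.prod_nil, mul_one, len_zpow] at hlZ
      have hp : p * (n - 1) = 2 := by
        have : (n : ℤ) * (p * (n - 1)) = n * 2 := by linear_combination 2 * hlZ - p * hD
        exact mul_left_cancel₀ (by omega) this
      have hp0 : 0 < p := by nlinarith
      nlinarith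
    · simpa using IsCycling.cons s 0 s [] hnf

/-! ### Combinatorics of the cycle form -/

theorem formPerm_map {α : Type*} [DecidableEq α] (g : Equiv.Perm α) (l : List α) :
    (l.map g).formPerm = g * l.formPerm * g⁻¹ := by
  match l with
  | [] => simp
  | [x] => simp
  | x :: y :: l =>
    have ih := formPerm_map g (y :: l)
    rw [List.map_cons] at ih
    rw [List.map_cons, List.map_cons, List.formPerm_cons_cons, List.formPerm_cons_cons, ih,
      Equiv.swap_apply_apply]
    group

theorem formPerm_append_cons_cons {α : Type*} [DecidableEq α] {l₁ l₂ : List α} {x y : α}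
    (h : (l₁ ++ x :: y :: l₂).Nodup) : (l₁ ++ x :: y :: l₂).formPerm x = y := by
  rw [List.formPerm_eq_of_isRotated h (l' := x :: y :: l₂ ++ l₁) List.isRotated_append]
  exact List.formPerm_apply_head _ _ _ (by simpa using (List.nodup_append_comm.1 h))

namespace HasEpsilonCycleForm

variable {hn : 1 ≤ n} {f : Equiv.Perm (Puncture n)} {a x : Puncture n} {u d : List (Puncture n)}

theorem nodup_cycleList (h : HasEpsilonCycleForm hn f a u d) : (cycleList hn u d).Nodup :=
  h.nodup.of_cons

theorem apply_fixed (h : HasEpsilonCycleForm hn f a u d) : f a = a := by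
  rw [h.eq_cycle, List.formPerm_apply_of_notMem]
  exact (List.nodup_cons.1 h.nodup).1

/-- The listed points are distinct and `r + t + 3 = n` of them are listed, so every puncture occurs.
-/
theorem mem_cases (h : HasEpsilonCycleForm hn f a u d) (x : Puncture n) :
    x = a ∨ x ∈ ⟨1, le_refl 1, hn⟩ :: u ∨ x ∈ ⟨n, hn, le_refl n⟩ :: d.reverse := by
  have hcard : (a :: cycleList hn u d).toFinset = Finset.univ := by
    rw [← Finset.card_eq_iff_eq_univ, List.toFinset_card_of_nodup h.nodup,
      show Fintype.card (Puncture n) = n by simp]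
    have := h.length_eq
    simp only [cycleList, List.length_cons, List.length_append, List.length_reverse]
    omega
  have hx : x ∈ a :: cycleList hn u d := by
    rw [← List.mem_toFinset, hcard]
    exact Finset.mem_univ x
  simpa [cycleList, or_assoc] using hx

theorem fixed_ne_one (h : HasEpsilonCycleForm hn f a u d) : (a : ℕ) ≠ 1 := fun ha =>
  (List.nodup_cons.1 h.nodup).1
    (by rw [show a = ⟨1, le_refl 1, hn⟩ from Subtype.ext ha]; simp [cycleList])

theorem fixed_ne_top (h : HasEpsilonCycleForm hn f a u d) : (a : ℕ) ≠ n := fun ha =>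
  (List.nodup_cons.1 h.nodup).1
    (by rw [show a = ⟨n, hn, le_refl n⟩ from Subtype.ext ha]; simp [cycleList])

theorem pairwise_cons (h : HasEpsilonCycleForm hn f a u d) :
    (⟨1, le_refl 1, hn⟩ :: u).Pairwise (· < ·) := by
  refine List.pairwise_cons.2 ⟨fun y hy => ?_, h.increasing_u⟩
  refine lt_of_le_of_ne (Subtype.coe_le_coe.1 y.2.1) ?_
  rintro rfl
  have := h.nodup_cycleList
  simp [cycleList, hy] at this

theorem lt_top_of_mem (h : HasEpsilonCycleForm hn f a u d)
    (hx : x ∈ ⟨1, le_refl 1, hn⟩ :: u ∨ x ∈ d) : x < ⟨n, hn, le_refl n⟩ := by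
  refine lt_of_le_of_ne (Subtype.coe_le_coe.1 x.2.2) ?_
  rintro rfl
  have := h.nodup_cycleList
  rw [cycleList, ← List.cons_append, List.nodup_append] at this
  obtain ⟨-, h1, h2⟩ := this
  rcases hx with hx | hx
  · exact h2 _ hx _ (by simp) rfl
  · simp [hx] at h1

theorem lt_apply (h : HasEpsilonCycleForm hn f a u d) (hx : x ∈ ⟨1, le_refl 1, hn⟩ :: u) :
    x < f x := by
  obtain ⟨l₁, l₂, hl⟩ := List.append_of_mem hx
  have hnd := h.nodup_cycleList
  have hp := h.pairwise_cons
  have he := h.eq_cycle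
  rw [cycleList, ← List.cons_append, hl, List.append_assoc] at hnd he
  cases l₂ with
  | nil =>
    rw [he]
    rw [List.cons_append, List.nil_append] at hnd ⊢
    rw [formPerm_append_cons_cons hnd]
    exact h.lt_top_of_mem (Or.inl hx)
  | cons y l₂ =>
    rw [he]
    rw [List.cons_append, List.cons_append] at hnd ⊢
    rw [formPerm_append_cons_cons hnd]
    rw [hl, List.pairwise_append] at hp
    exact (List.pairwise_cons.1 hp.2.1).1 y (by simp)

variable {k : Puncture n}

theorem apply_head (h : HasEpsilonCycleForm hn f a u (k :: d)) : f k = ⟨1, le_refl 1, hn⟩ := by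
  have e : cycleList hn u (k :: d) =
      ⟨1, le_refl 1, hn⟩ :: ((u ++ ⟨n, hn, le_refl n⟩ :: d.reverse) ++ [k]) := by
    simp [cycleList]
  rw [h.eq_cycle, e]
  exact List.formPerm_cons_concat_apply_last _ _ _

theorem exists_apply_eq_head (h : HasEpsilonCycleForm hn f a u (k :: d)) :
    ∃ x, f x = k ∧ k < x := by
  have hnd := h.nodup_cycleList
  have he := h.eq_cycle
  cases d with
  | nil =>
    refine ⟨_, ?_, h.lt_top_of_mem (Or.inr (by simp))⟩
    rw [cycleList, ← List.cons_append, List.reverse_singleton] at hnd he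
    rw [he, formPerm_append_cons_cons hnd]
  | cons y d =>
    refine ⟨y, ?_, (List.pairwise_cons.1 h.increasing_d).1 y (by simp)⟩
    have e : cycleList hn u (k :: y :: d) =
        (⟨1, le_refl 1, hn⟩ :: (u ++ ⟨n, hn, le_refl n⟩ :: d.reverse)) ++ y :: k :: [] := by
      simp [cycleList]
    rw [e] at hnd he
    rw [he, formPerm_append_cons_cons hnd]

/-- Only points of the branch `n, d_t, …, d_1` move down. Their images are again some `d_i`, hence
at least the least one `k`, except for `k` itself, which goes to `1`. -/
theorem le_apply_of_apply_lt (h : HasEpsilonCycleForm hn f a u (k :: d)) (hx : f x < x) :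
    x = k ∨ k ≤ f x := by
  rcases h.mem_cases x with rfl | hm | hm
  · exact absurd h.apply_fixed hx.ne
  · exact absurd (h.lt_apply hm) hx.not_gt
  · rw [List.reverse_cons, ← List.cons_append, List.mem_append] at hm
    rcases hm with hm | hm
    · right
      obtain ⟨l₁, l₂, hl⟩ := List.append_of_mem hm
      obtain ⟨y, l₃, hl₃⟩ := List.exists_cons_of_ne_nil (l := l₂ ++ [k]) (by simp)
      have hnd := h.nodup_cycleList
      have he := h.eq_cycle
      have e : cycleList hn u (k :: d) =
          ((⟨1, le_refl 1, hn⟩ :: u) ++ l₁) ++ x :: y :: l₃ := by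
        rw [← hl₃, cycleList, List.reverse_cons, ← List.cons_append (as := d.reverse), hl]
        simp
      rw [e] at hnd he
      rw [he, formPerm_append_cons_cons hnd]
      have hy : y ∈ l₂ ++ [k] := by simp [hl₃]
      rcases List.mem_append.1 hy with hy | hy
      · have : y ∈ d := by
          cases l₁ with
          | nil =>
            rw [List.nil_append, List.cons.injEq] at hl
            rw [← List.mem_reverse, hl.2]
            exact hy
          | cons z l₁ =>
            rw [List.cons_append, List.cons.injEq] at hl
            rw [← List.mem_reverse, hl.2]
            simp [hy]
        exact ((List.pairwise_cons.1 h.increasing_d).1 y this).le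
      · exact (List.mem_singleton.1 hy).ge
    · exact Or.inl (List.mem_singleton.1 hm)

/-- The relabelling `g` sends `k` to `1`, shifts `1, …, k-1` up by one and fixes everything above
`k`, in particular the rest of `d`. So `k` becomes the new start of the ascending branch, and the
old start `1` becomes its second entry. -/
theorem conj_perm_sigmaDown (h : HasEpsilonCycleForm hn f a u (k :: d))
    {g : Equiv.Perm (Puncture n)} (hg : g = perm (sigmaDown n k 1)) :
    HasEpsilonCycleForm hn (g * f * g⁻¹) (g a) ((⟨1, le_refl 1, hn⟩ :: u).map g) d := by
  have hg' (x : Puncture n) : (g x : ℕ) =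
      if (x : ℕ) = k then 1 else if 1 ≤ (x : ℕ) ∧ (x : ℕ) < k then (x : ℕ) + 1 else x := by
    rw [hg]
    exact perm_sigmaDown le_rfl k.2.1 k.2.2 x
  have hk1 : g k = ⟨1, le_refl 1, hn⟩ := by
    refine Subtype.ext ?_
    rw [hg', if_pos rfl]
  have hfix (x : Puncture n) (hx : k < x) : g x = x := by
    have hx : (k : ℕ) < x := hx
    refine Subtype.ext ?_
    rw [hg', if_neg (by omega), if_neg (by omega)]
  have hmono (x y : Puncture n) (hx : x ≠ k) (hy : y ≠ k) (hxy : x < y) : g x < g y := by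
    rw [← Subtype.coe_lt_coe] at hxy ⊢
    rw [Ne, Subtype.ext_iff] at hx hy
    have := x.2.1
    rw [hg', hg']
    split_ifs <;> omega
  have htop : g ⟨n, hn, le_refl n⟩ = ⟨n, hn, le_refl n⟩ :=
    hfix _ (h.lt_top_of_mem (Or.inr (by simp)))
  have hd : (d.reverse).map g = d.reverse := by
    conv_rhs => rw [← List.map_id d.reverse]
    refine List.map_congr_left fun x hx => ?_
    exact hfix x ((List.pairwise_cons.1 h.increasing_d).1 x (List.mem_reverse.1 hx))
  -- The relabelled list ends in `g k = 1`, whereas `cycleList` begins with `1`.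
  have hrot : cycleList hn ((⟨1, le_refl 1, hn⟩ :: u).map g) d ~r
      (cycleList hn u (k :: d)).map g := by
    have e1 : cycleList hn ((⟨1, le_refl 1, hn⟩ :: u).map g) d = [⟨1, le_refl 1, hn⟩] ++
        ((⟨1, le_refl 1, hn⟩ :: u).map g ++ ⟨n, hn, le_refl n⟩ :: d.reverse) := rfl
    have e2 : (cycleList hn u (k :: d)).map g = ((⟨1, le_refl 1, hn⟩ :: u).map g ++
        ⟨n, hn, le_refl n⟩ :: d.reverse) ++ [⟨1, le_refl 1, hn⟩] := by
      simp only [cycleList, List.reverse_cons, List.map_cons, List.map_append, htop, hd,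
        List.map_nil, hk1, List.append_assoc, List.cons_append]
    rw [e1, e2]
    exact List.isRotated_append
  have hnd : (a :: cycleList hn u (k :: d)).map g |>.Nodup :=
    (List.nodup_map_iff g.injective).2 h.nodup
  rw [List.map_cons, List.nodup_cons] at hnd
  refine ⟨List.nodup_cons.2 ⟨fun hm => hnd.1 (hrot.mem_iff.1 hm), hrot.nodup_iff.2 hnd.2⟩, ?_, ?_,
    (List.pairwise_cons.1 h.increasing_d).2, ?_⟩
  · have := h.length_eq
    simp only [List.length_cons, List.length_map] at this ⊢
    omega
  · rw [List.pairwise_map]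
    have hne (x : Puncture n) (hx : x ∈ ⟨1, le_refl 1, hn⟩ :: u) : x ≠ k := by
      rintro rfl
      have := h.lt_apply hx
      rw [h.apply_head, ← Subtype.coe_lt_coe] at this
      exact absurd x.2.1 (by simpa using this)
    exact h.pairwise_cons.imp_of_mem fun {x y} hx hy hxy => hmono x y (hne x hx) (hne y hy) hxy
  · rw [List.formPerm_eq_of_isRotated (hrot.nodup_iff.2 hnd.2) hrot, formPerm_map, h.eq_cycle]

end HasEpsilonCycleForm

/-! ### Conjugating a braid of the given form to `ε` -/

theorem lastBelow_le_iff {a : Puncture n} {d : List (Puncture n)} {m : ℕ} :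
    lastBelow a d ≤ m ↔ ∀ i : Fin d.length, d.get i < a → (i : ℕ) + 1 ≤ m := by
  simp [lastBelow]

theorem lastBelow_cons_of_lt {a k : Puncture n} (d : List (Puncture n)) (h : k < a) :
    lastBelow a (k :: d) = lastBelow a d + 1 := by
  refine eq_of_forall_ge_iff fun m => ?_
  rw [lastBelow_le_iff]
  cases m with
  | zero =>
    refine iff_of_false (fun H => ?_) (by simp)
    exact absurd (H ⟨0, by simp⟩ h) (by simp)
  | succ m =>
    rw [show lastBelow a d + 1 ≤ m + 1 ↔ lastBelow a d ≤ m from add_le_add_iff_right 1,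
      lastBelow_le_iff]
    simp only [List.length_cons, Fin.forall_fin_succ]
    simp

theorem lastBelow_eq_zero {a : Puncture n} {d : List (Puncture n)} (h : ∀ x ∈ d, ¬ x < a) :
    lastBelow a d = 0 := by
  rw [← Nat.le_zero, lastBelow_le_iff]
  exact fun i hi => absurd hi (h _ (List.get_mem d i))

theorem inverts_perm_sigmaDown {i j : ℕ} (hi : 1 ≤ i) (hij : i ≤ j) (hj : j ≤ n)
    {x y : Puncture n} : Inverts (perm (sigmaDown n j i)) x y ↔
      ((x : ℕ) = j ∧ i ≤ (y : ℕ) ∧ (y : ℕ) < j) ∨ ((y : ℕ) = j ∧ i ≤ (x : ℕ) ∧ (x : ℕ) < j) := by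
  simp only [Inverts, ← Subtype.coe_lt_coe, perm_sigmaDown hi hij hj]
  split_ifs <;> omega

/-- Conjugation by `σ_{[k → 1]}`, where `k` is the least element of the descending part. -/
theorem IsSimple.conj_sigmaDown {hn : 1 ≤ n} {s : BraidGroup n} {a k : Puncture n}
    {u d : List (Puncture n)} (hs : IsSimple s)
    (h : HasEpsilonCycleForm hn (perm s) a u (k :: d)) :
    IsSimple ((sigmaDown n k 1)⁻¹ * s * sigmaDown n k 1) := by
  have hc : IsSimple (sigmaDown n k 1) := isSimple_sigmaDown le_rfl k.2.1 k.2.2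
  have hc' (x : Puncture n) : (perm (sigmaDown n k 1) x : ℕ) =
      if (x : ℕ) = k then 1 else if 1 ≤ (x : ℕ) ∧ (x : ℕ) < k then (x : ℕ) + 1 else x :=
    perm_sigmaDown le_rfl k.2.1 k.2.2 x
  have hci {x y : Puncture n} := inverts_perm_sigmaDown le_rfl k.2.1 k.2.2 (x := x) (y := y)
  obtain ⟨t, ht, htp⟩ := exists_isSimple (perm s * (perm (sigmaDown n k 1))⁻¹)
  have htp' (x : Puncture n) : perm t (perm (sigmaDown n k 1) x) = perm s x := by
    simp [htp]
  -- `σ_{[k → 1]}` crosses the strand from `k` with all strands to its left. The braid `s` sends `k`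
  -- to `1`, so it crosses these pairs too, and `t` must not cross them again.
  have hst : sigmaDown n k 1 * t = s := by
    refine IsSimple.eq_of_perm_eq (hc.mul ht fun x y hxy => ?_) hs ?_
    · wlog hx : (x : ℕ) = k ∧ 1 ≤ (y : ℕ) ∧ (y : ℕ) < k generalizing x y
      · rw [hci] at hxy
        exact fun H => this y x (hci.2 hxy.symm) (hxy.resolve_left hx) H.symm
      obtain rfl : x = k := Subtype.ext hx.1
      have hy : y ≠ x := fun e => by rw [e] at hx; omega
      have h1 : ((perm s) y : ℕ) ≠ 1 := fun e => hy ((perm s).injective (by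
        rw [h.apply_head]
        exact Subtype.ext e))
      have := ((perm s) y).2.1
      have hcx : (perm (sigmaDown n x 1) x : ℕ) = 1 := by rw [hc', if_pos rfl]
      simp only [htp', Inverts, h.apply_head, ← Subtype.coe_lt_coe, hcx]
      rw [hc']
      split_ifs <;> omega
    · rw [perm_mul, htp, inv_mul_cancel_right]
  rw [← hst, inv_mul_cancel_left]
  refine ht.mul hc fun p q hpq H => ?_
  obtain ⟨x, rfl⟩ := (perm (sigmaDown n k 1)).surjective p
  obtain ⟨y, rfl⟩ := (perm (sigmaDown n k 1)).surjective q
  wlog hx : (perm s x : ℕ) = k ∧ (perm s y : ℕ) < k generalizing x y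
  · refine this y x hpq.symm H.symm ?_
    rw [hci] at H
    simp only [htp'] at H
    tauto
  simp only [htp', Inverts, ← Subtype.coe_lt_coe, hc'] at hpq
  obtain ⟨z, hz, hkz⟩ := h.exists_apply_eq_head
  obtain rfl : x = z := (perm s).injective (by rw [hz]; exact Subtype.ext hx.1)
  -- The final `σ_{[k → 1]}` crosses the strand ending at `k`, which starts at `x > k`, with those
  -- ending below `k`. A strand from `y ≥ x` ending below `k` would move down past `k`, which only
  -- the one from `k` does. So `y < x`, and `t` has not crossed this pair.
  have hyx : (y : ℕ) < x := by
    have hkz : (k : ℕ) < x := hkz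
    by_contra! hle
    have hlt : perm s y < y := by
      rw [← Subtype.coe_lt_coe]
      omega
    rcases h.le_apply_of_apply_lt hlt with rfl | h'
    · omega
    · rw [← Subtype.coe_le_coe] at h'
      omega
  have hkz : (k : ℕ) < x := hkz
  have := y.2.1
  rw [if_neg (by omega), if_neg (by omega)] at hpq
  split_ifs at hpq <;> omega

/-- Without a descending branch, every point other than `a` and `n` moves up and avoids `a`. Hence
`f` dominates the conjugate of `π_ε` pointwise, which forces equality. -/
theorem HasEpsilonCycleForm.coe_apply_of_nil {hn : 1 ≤ n} {f : Equiv.Perm (Puncture n)}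
    {a : Puncture n} {u : List (Puncture n)} (hn3 : 3 ≤ n) (h : HasEpsilonCycleForm hn f a u []) :
    f = (perm (sigmaDown n a 2))⁻¹ * perm (epsilon n) * perm (sigmaDown n a 2) ∧
    ∀ x, (f x : ℕ) = if (x : ℕ) = a then (a : ℕ) else if (x : ℕ) = n then 1 else
      if (x : ℕ) + 1 = a then (a : ℕ) + 1 else (x : ℕ) + 1 := by
  have ha1 := h.fixed_ne_one
  have han := h.fixed_ne_top
  have ha := a.2.1
  have ha' := a.2.2
  have hc (x : Puncture n) := perm_sigmaDown (n := n) (i := 2) (j := a) (by omega) (by omega) ha' x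
  have hε (x : Puncture n) := perm_epsilon hn3 x
  have hν (x : Puncture n) :
      (((perm (sigmaDown n a 2))⁻¹ * perm (epsilon n) * perm (sigmaDown n a 2)) x : ℕ) =
      if (x : ℕ) = a then (a : ℕ) else if (x : ℕ) = n then 1 else
        if (x : ℕ) + 1 = a then (a : ℕ) + 1 else (x : ℕ) + 1 := by
    obtain ⟨z, hz⟩ : ∃ z, z =
      ((perm (sigmaDown n a 2))⁻¹ * perm (epsilon n) * perm (sigmaDown n a 2)) x := ⟨_, rfl⟩
    rw [← hz]
    rw [Equiv.Perm.mul_apply, Equiv.Perm.mul_apply, Equiv.Perm.eq_inv_iff_eq, Subtype.ext_iff,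
      hc, hε, hc] at hz
    have := x.2.1
    have := x.2.2
    have := z.2.1
    have := z.2.2
    clear hc hε
    split_ifs at hz <;> split_ifs <;> omega
  have key : f = (perm (sigmaDown n a 2))⁻¹ * perm (epsilon n) * perm (sigmaDown n a 2) := by
    symm
    refine perm_eq_of_forall_le fun x => ?_
    rw [← Subtype.coe_le_coe, hν]
    have hfa : x ≠ a → f x ≠ a := fun hx hfx => hx (f.injective (hfx.trans h.apply_fixed.symm))
    have := (f x).2.1
    rcases h.mem_cases x with rfl | hm | hm
    · rw [if_pos rfl, h.apply_fixed]
    · have hx := h.lt_apply hm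
      have hxn := h.lt_top_of_mem (Or.inl hm)
      rw [← Subtype.coe_lt_coe] at hx hxn
      simp only [Ne, Subtype.ext_iff] at hfa
      split_ifs <;> omega
    · obtain rfl : x = ⟨n, hn, le_refl n⟩ := by simpa using hm
      rw [if_neg (Ne.symm han), if_pos rfl]
      omega
  exact ⟨key, fun x => by rw [key, hν]⟩

theorem beta_conj {hn : 1 ≤ n} (hn3 : 3 ≤ n) {s : BraidGroup n} {a : Puncture n}
    {u d : List (Puncture n)} (hs : IsSimple s) (h : HasEpsilonCycleForm hn (perm s) a u d) :
    (beta a d)⁻¹ * s * beta a d = epsilon n := by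
  induction d generalizing s a u with
  | nil =>
    have ha1 := h.fixed_ne_one
    have han := h.fixed_ne_top
    have ha := a.2.1
    have ha' := a.2.2
    have hb : beta a [] = sigmaDown n a 2 := by
      simp [beta, bIndex, lastBelow_eq_zero]
    have hc : IsSimple (sigmaDown n a 2) := isSimple_sigmaDown (by omega) (by omega) ha'
    have hci {x y : Puncture n} := inverts_perm_sigmaDown (i := 2) (j := a) (by omega) (by omega)
      ha' (x := x) (y := y)
    obtain ⟨hconj, hf⟩ := h.coe_apply_of_nil hn3
    rw [hb, mul_assoc, inv_mul_eq_iff_eq_mul]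
    -- In the form `s c = c ε` both sides are simple, so only the permutations need comparison.
    refine IsSimple.eq_of_perm_eq (hs.mul hc fun j k hjk => ?_)
      (hc.mul (isSimple_epsilon hn3) fun j k hjk => ?_) ?_
    · rw [hci, hf, hf]
      simp only [Inverts, ← Subtype.coe_lt_coe, hf] at hjk
      have := j.2.1
      have := k.2.1
      split_ifs at hjk ⊢ <;> omega
    · rw [hci] at hjk
      simp only [Inverts, ← Subtype.coe_lt_coe, perm_epsilon hn3,
        perm_sigmaDown (n := n) (i := 2) (j := a) (by omega) (by omega) ha']
      rcases hjk with ⟨h1, h2, h3⟩ | ⟨h1, h2, h3⟩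
      · rw [if_pos h1, if_neg (by omega), if_pos ⟨h2, h3⟩]
        split_ifs <;> omega
      · rw [if_pos h1, if_neg (by omega), if_pos ⟨h2, h3⟩]
        split_ifs <;> omega
    · rw [perm_mul, perm_mul, hconj]
      group
  | cons k d ih =>
    have h' := h.conj_perm_sigmaDown rfl
    have e : perm ((sigmaDown n k 1)⁻¹ * s * sigmaDown n k 1) =
        perm (sigmaDown n k 1) * perm s * (perm (sigmaDown n k 1))⁻¹ := by
      rw [perm_mul, perm_mul, perm_inv, mul_assoc]
    rw [← e] at h'
    have ih := ih (hs.conj_sigmaDown h) h'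
    have hb : beta a (k :: d) = sigmaDown n k 1 * beta (perm (sigmaDown n k 1) a) d := by
      have hka : k ≠ a := by
        rintro rfl
        exact h.fixed_ne_one (by rw [← h.apply_fixed, h.apply_head])
      have hga := perm_sigmaDown (n := n) le_rfl k.2.1 k.2.2 a
      -- If `k < a`, then `a` stays while `t` and the maximum both drop by one. If `a < k`, then `a`
      -- rises by one, `t` drops by one, and the maximum is `0` before and after.
      have hidx : bIndex a (k :: d) = bIndex (perm (sigmaDown n k 1) a) d := by
        have ha1 := a.2.1
        rcases lt_or_gt_of_ne hka with hlt | hgt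
        · have hlt' : (k : ℕ) < a := hlt
          rw [if_neg (by omega), if_neg (by omega)] at hga
          rw [Subtype.ext hga, bIndex, bIndex, lastBelow_cons_of_lt d hlt, List.length_cons]
          omega
        · have hgt' : (a : ℕ) < k := hgt
          rw [if_neg (by omega), if_pos (by omega)] at hga
          have hall := (List.pairwise_cons.1 h.increasing_d).1
          rw [bIndex, bIndex, hga, lastBelow_eq_zero, lastBelow_eq_zero, List.length_cons]
          · omega
          · intro x hx hlt
            have h1 := hall x hx
            rw [← Subtype.coe_lt_coe] at h1 hlt
            omega
          · intro x hx hlt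
            rcases List.mem_cons.1 hx with rfl | hx
            · exact lt_asymm hlt hgt
            · exact lt_asymm hlt (hgt.trans (hall x hx))
      simp [beta, hidx, mul_assoc]
    rw [hb, ← ih]
    group

theorem HasEpsilonCycleForm.beta_eq_one (a : Puncture 3) {f : Equiv.Perm (Puncture 3)}
    {u d : List (Puncture 3)} {hn : 1 ≤ 3} (h : HasEpsilonCycleForm hn f a u d) :
    beta a d = 1 := by
  have hl := h.length_eq
  obtain rfl : d = [] := List.eq_nil_of_length_eq_zero (by omega)
  have ha : (a : ℕ) = 2 := by
    have := a.2.1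
    have := a.2.2
    have := h.fixed_ne_one
    have := h.fixed_ne_top
    omega
  simp [beta, bIndex, lastBelow_eq_zero, ha, sigmaDown_self]

theorem mem_USS_epsilon_of_form {hn : 1 ≤ n} (hn3 : 3 ≤ n) {s : BraidGroup n} {a : Puncture n}
    {u d : List (Puncture n)} (hs : IsSimple s) (h : HasEpsilonCycleForm hn (perm s) a u d) :
    s ∈ USS (epsilon n) := by
  have hβ := beta_conj hn3 hs h
  refine hs.mem_USS_epsilon hn3 (isConj_iff.2 ⟨beta a d, ?_⟩) ?_
  · rw [← hβ]
    group
  · rintro rfl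
    rw [← hβ, h.beta_eq_one]
    group

/-! ### Crossing invariants of conjugacy, and the simple conjugates of `ε` -/

/-- For a map `φ` which commutes with the permutation of `t`, the sum of the crossing numbers of
the pairs `(x, φ x)` is invariant under conjugation. -/
theorem sum_crossNum_conj {X s t : BraidGroup n} (h : X * s = t * X)
    {φ : Puncture n → Puncture n} (hφ : ∀ x, φ (perm t x) = perm t (φ x)) :
    ∑ x, crossNum s (perm X x) (perm X (φ x)) = ∑ x, crossNum t x (φ x) := by
  -- The contribution of `X` is a difference of one function at `perm t x` and at `x`, so it
  -- vanishes on summing over the permutation.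
  have key (x : Puncture n) : crossNum s (perm X x) (perm X (φ x)) =
      crossNum t x (φ x) +
        (crossNum X (perm t x) (φ (perm t x)) - crossNum X x (φ x)) := by
    have := congrArg (fun Y => crossNum Y x (φ x)) h
    simp only [crossNum_mul] at this
    rw [hφ]
    linarith
  rw [Finset.sum_congr rfl fun x _ => key x, Finset.sum_add_distrib, Finset.sum_sub_distrib,
    Equiv.sum_comp (perm t) (fun x => crossNum X x (φ x)), sub_self, add_zero]

/-- The cycle of `π_ε` is `1, 3, 4, …, n`, so it takes `m + 1` steps from `1` to `m + 3`. -/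
theorem perm_epsilon_pow (hn : 3 ≤ n) (m : ℕ) (hm : m + 3 ≤ n) :
    ((perm (epsilon n) ^ (m + 1)) ⟨1, le_refl 1, by omega⟩ : Puncture n) =
      ⟨m + 3, by omega, hm⟩ := by
  induction m with
  | zero =>
    refine Subtype.ext ?_
    rw [zero_add, pow_one, perm_epsilon hn]
    dsimp only
    rw [if_neg (by omega), if_pos rfl]
  | succ m ih =>
    rw [pow_succ', Equiv.Perm.mul_apply, ih (by omega)]
    refine Subtype.ext ?_
    rw [perm_epsilon hn]
    dsimp only
    split_ifs <;> omega

theorem perm_epsilon_apply_eq_self_iff (hn : 3 ≤ n) (x : Puncture n) :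
    perm (epsilon n) x = x ↔ (x : ℕ) = 2 := by
  rw [Subtype.ext_iff, perm_epsilon hn]
  split_ifs <;> omega

theorem isCycle_perm_epsilon (hn : 3 ≤ n) : (perm (epsilon n)).IsCycle := by
  refine ⟨⟨1, le_refl 1, by omega⟩, ?_, fun y hy => ?_⟩
  · rw [Ne, perm_epsilon_apply_eq_self_iff hn]
    simp
  · rw [Ne, perm_epsilon_apply_eq_self_iff hn] at hy
    by_cases h1 : (y : ℕ) = 1
    · exact ⟨0, by simpa using Subtype.ext h1.symm⟩
    · have := y.2.1
      have := y.2.2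
      refine ⟨((y - 3 + 1 : ℕ) : ℕ), ?_⟩
      rw [zpow_natCast, perm_epsilon_pow hn _ (by omega)]
      exact Subtype.ext (by simp; omega)

/-- The combinatorial content of being a simple conjugate of `ε`: an `(n - 1)`-cycle whose fixed
point is interior and whose only local extrema are `1` and `n`. -/
structure IsUnimodalCycle (f : Equiv.Perm (Puncture n)) (a : Puncture n) : Prop where
  isCycle : f.IsCycle
  apply_eq_self_iff : ∀ x, f x = x ↔ x = a
  ne_one : (a : ℕ) ≠ 1
  ne_top : (a : ℕ) ≠ n
  extremum : ∀ x, Inverts f x (f x) → (f x : ℕ) = 1 ∨ (f x : ℕ) = n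

theorem IsSimple.isUnimodalCycle (hn : 3 ≤ n) {s : BraidGroup n} (hs : IsSimple s)
    (hc : IsConj (epsilon n) s) : ∃ a, IsUnimodalCycle (perm s) a := by
  obtain ⟨c, hc⟩ := isConj_iff.1 hc
  obtain ⟨X, hX⟩ : ∃ X, X = c⁻¹ := ⟨_, rfl⟩
  have hXs : X * s = epsilon n * X := by
    rw [hX, ← hc]
    group
  obtain ⟨two, htwo⟩ : ∃ two : Puncture n, (two : ℕ) = 2 := ⟨⟨2, by omega, by omega⟩, rfl⟩
  have hε2 : perm (epsilon n) two = two := (perm_epsilon_apply_eq_self_iff hn two).2 htwo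
  have hπ (x : Puncture n) : perm s (perm X x) = perm X (perm (epsilon n) x) := by
    have := congrArg (fun Y => perm Y x) hXs
    simpa [perm_mul] using this
  have hπ' : perm s = perm X * perm (epsilon n) * (perm X)⁻¹ := by
    rw [eq_mul_inv_iff_mul_eq]
    ext1 x
    exact hπ x
  have hfix (x : Puncture n) : perm s x = x ↔ x = perm X two := by
    obtain ⟨y, rfl⟩ := (perm X).surjective x
    rw [hπ, (perm X).apply_eq_iff_eq, (perm X).apply_eq_iff_eq,
      perm_epsilon_apply_eq_self_iff hn, Subtype.ext_iff, htwo]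
  have ha := (hfix _).2 rfl
  -- With `φ` constant at the fixed point, the invariant is the total crossing with the fixed
  -- strand. It is positive for `ε`, whose strand from `n` to `1` crosses the strand at `2`.
  have hinv : ∃ z, Inverts (perm s) z (perm X two) := by
    by_contra! hno
    have h1 := sum_crossNum_conj hXs (φ := fun _ => two) (fun _ => hε2.symm)
    simp only [hs.crossNum_eq, (isSimple_epsilon hn).crossNum_eq, hno] at h1
    have h2 : Inverts (perm (epsilon n)) ⟨n, by omega, le_refl n⟩ two := by
      simp only [Inverts, ← Subtype.coe_lt_coe, perm_epsilon hn]
      rw [htwo]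
      refine Or.inr ⟨by omega, ?_⟩
      rw [if_pos trivial, if_neg (by omega), if_neg (by omega), if_pos rfl]
      omega
    have := Finset.single_le_sum
      (f := fun x => if Inverts (perm (epsilon n)) x two then (1 : ℤ) else 0)
      (fun x _ => by positivity) (Finset.mem_univ ⟨n, by omega, le_refl n⟩)
    rw [← h1, if_pos h2] at this
    simp at this
  -- A strand crossing the fixed one starts and ends on opposite sides of it.
  have hbd : (perm X two : ℕ) ≠ 1 ∧ (perm X two : ℕ) ≠ n := by
    obtain ⟨z, hz⟩ := hinv
    simp only [Inverts, ha, ← Subtype.coe_lt_coe] at hz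
    have := z.2.1
    have := z.2.2
    have := (perm s z).2.1
    have := (perm s z).2.2
    omega
  have hcyc : (perm s).IsCycle := hπ' ▸ (isCycle_perm_epsilon hn).conj
  refine ⟨perm X two, hcyc, hfix, hbd.1, hbd.2, fun x hx => ?_⟩
  by_contra! hne
  obtain ⟨one, hone⟩ : ∃ one : Puncture n, (one : ℕ) = 1 := ⟨⟨1, by omega, by omega⟩, rfl⟩
  obtain ⟨top, htop⟩ : ∃ top : Puncture n, (top : ℕ) = n := ⟨⟨n, by omega, le_refl n⟩, rfl⟩
  -- With `φ = π_ε`, the invariant counts the `x` for which `(x, f x)` is inverted, that is, for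
  -- which the step into `f x` and the step out of it go in opposite directions.
  have h1 := sum_crossNum_conj hXs (φ := perm (epsilon n)) (fun _ => rfl)
  simp only [hs.crossNum_eq, (isSimple_epsilon hn).crossNum_eq, ← hπ] at h1
  rw [Equiv.sum_comp (perm X) (fun x => if Inverts (perm s) x (perm s x) then (1 : ℤ) else 0)] at h1
  simp only [Finset.sum_boole, Nat.cast_inj] at h1
  have hle : (Finset.univ.filter fun x => Inverts (perm (epsilon n)) x (perm (epsilon n) x)).card ≤
      2 := by
    refine (Finset.card_le_card (t := {(perm (epsilon n))⁻¹ one, (perm (epsilon n))⁻¹ top})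
      fun y hy => ?_).trans Finset.card_le_two
    have hy := (Finset.mem_filter.1 hy).2
    simp only [Inverts, ← Subtype.coe_lt_coe, perm_epsilon hn] at hy
    rw [Finset.mem_insert, Finset.mem_singleton, Equiv.Perm.eq_inv_iff_eq,
      Equiv.Perm.eq_inv_iff_eq, Subtype.ext_iff, Subtype.ext_iff, perm_epsilon hn, hone, htop]
    have := y.2.1
    have := y.2.2
    split_ifs at hy ⊢ <;> omega
  obtain ⟨p, hp⟩ := (perm s).surjective one
  obtain ⟨q, hq⟩ := (perm s).surjective top
  have hone' : (perm s one : ℕ) ≠ 1 := fun h =>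
    hbd.1 (by rw [← (hfix one).1 (Subtype.ext (h.trans hone.symm)), hone])
  have htop' : (perm s top : ℕ) ≠ n := fun h =>
    hbd.2 (by rw [← (hfix top).1 (Subtype.ext (h.trans htop.symm)), htop])
  -- Neither `1` nor `n` is fixed, so both are extrema of the cycle and use up the two available;
  -- `x` would be a third.
  have hpi : Inverts (perm s) p (perm s p) := by
    have : (p : ℕ) ≠ 1 := fun h => hone' (by
      rw [← show p = one from Subtype.ext (h.trans hone.symm), hp, hone])
    have := p.2.1
    have := (perm s one).2.1
    simp only [Inverts, hp, ← Subtype.coe_lt_coe, hone]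
    omega
  have hqi : Inverts (perm s) q (perm s q) := by
    have : (q : ℕ) ≠ n := fun h => htop' (by
      rw [← show q = top from Subtype.ext (h.trans htop.symm), hq, htop])
    have := q.2.2
    have := (perm s top).2.2
    simp only [Inverts, hq, ← Subtype.coe_lt_coe, htop]
    omega
  have hcard : ({p, q, x} : Finset (Puncture n)).card = 3 := by
    refine Finset.card_eq_three.2 ⟨p, q, x, ?_, ?_, ?_, rfl⟩
    · rintro rfl
      rw [hp] at hq
      rw [hq, htop] at hone
      omega
    · rintro rfl
      exact hne.1 (by rw [hp, hone])
    · rintro rfl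
      exact hne.2 (by rw [hq, htop])
  have hge := Finset.card_le_card (s := {p, q, x})
    (t := Finset.univ.filter fun x => Inverts (perm s) x (perm s x)) fun y hy => by
      rw [Finset.mem_filter]
      refine ⟨Finset.mem_univ y, ?_⟩
      simp only [Finset.mem_insert, Finset.mem_singleton] at hy
      rcases hy with rfl | rfl | rfl
      exacts [hpi, hqi, hx]
  omega

/-! ### From a unimodal cycle to the cycle form -/

namespace IsUnimodalCycle

variable {f : Equiv.Perm (Puncture n)} {a : Puncture n}

/-- A unimodal cycle, listed from `1` on, increases up to `n` and decreases afterwards. -/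
theorem getElem_lt (h : IsUnimodalCycle f a) {l : List (Puncture n)} (hl : l.Nodup)
    (hf : ∀ i (hi : i + 1 < l.length), f l[i] = l[i + 1]) {m : ℕ} (hm : m < l.length)
    (h0 : (l[0] : ℕ) = 1) (hm' : (l[m] : ℕ) = n) (i : ℕ) (hi : i + 1 < l.length) :
    (i < m → l[i] < l[i + 1]) ∧ (m ≤ i → l[i + 1] < l[i]) := by
  have hne (i j : ℕ) (hi : i < l.length) (hj : j < l.length) (hij : i ≠ j) :
      (l[i] : ℕ) ≠ l[j] := fun e => hij ((hl.getElem_inj_iff).1 (Subtype.ext e))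
  have hpeak : ∀ (j : ℕ) (hj : j + 1 < l.length), m = j → l[j + 1] < l[j] := by
    rintro _ hj rfl
    rw [← Subtype.coe_lt_coe, hm']
    exact lt_of_le_of_ne l[m + 1].2.2 fun e => hne _ _ hj hm (by omega) (e.trans hm'.symm)
  induction i with
  | zero =>
    refine ⟨fun _ => ?_, fun h => hpeak 0 hi (by omega)⟩
    rw [← Subtype.coe_lt_coe, h0]
    exact lt_of_le_of_ne l[0 + 1].2.1 fun e => hne 0 1 (by omega) hi (by omega) (h0.trans e)
  | succ i ih =>
    obtain ⟨ih1, ih2⟩ := ih (by omega) hpeak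
    rcases eq_or_ne m (i + 1) with hmi | hmi
    · exact ⟨fun h => by omega, fun _ => hpeak _ hi hmi⟩
    -- The entry `l[i + 1]` is neither `1` nor `n`, hence no extremum: the direction of the previous
    -- step persists.
    · have hno : ¬ Inverts f l[i] (f l[i]) := fun H => by
        rcases h.extremum _ H with e | e
        · rw [hf i (by omega)] at e
          exact hne _ _ _ _ (by omega) (e.trans h0.symm)
        · rw [hf i (by omega)] at e
          exact hne _ _ _ _ (by omega) (e.trans hm'.symm)
      have hne' := hne (i + 1 + 1) (i + 1) hi (by omega) (by omega)
      simp only [Inverts, hf i (by omega), hf (i + 1) hi, not_or, not_and, not_lt,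
        ← Subtype.coe_lt_coe] at hno ih1 ih2 ⊢
      refine ⟨fun h => ?_, fun h => ?_⟩
      · have := hno.1 (ih1 (by omega))
        omega
      · have := hno.2 (ih2 (by omega))
        omega

/-- The orbit of `1`, listed from `1`, omits only `a`. Cutting it at `n` gives `u` before the cut
and the reverse of `d` after it. -/
theorem exists_hasEpsilonCycleForm (h : IsUnimodalCycle f a) (hn : 1 ≤ n) :
    ∃ u d, HasEpsilonCycleForm hn f a u d := by
  obtain ⟨one, hone⟩ : ∃ one : Puncture n, one = ⟨1, le_refl 1, hn⟩ := ⟨_, rfl⟩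
  obtain ⟨top, htop⟩ : ∃ top : Puncture n, top = ⟨n, hn, le_refl n⟩ := ⟨_, rfl⟩
  have h1 : f one ≠ one := by
    rw [Ne, h.apply_eq_self_iff]
    rintro rfl
    exact h.ne_one (by rw [hone])
  have h1N : one ≠ top := by
    intro e
    have e : 1 = n := congrArg Subtype.val (hone.symm.trans (e.trans htop))
    have := a.2.1
    have := a.2.2
    have := h.ne_one
    omega
  obtain ⟨l, hl⟩ : ∃ l, l = f.toList one := ⟨_, rfl⟩
  have hnd : l.Nodup := hl ▸ Equiv.Perm.nodup_toList f one
  have hmem (x : Puncture n) : x ∈ l ↔ x ≠ a := by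
    rw [hl, Equiv.Perm.mem_toList_iff, Equiv.Perm.mem_support, and_iff_left h1, Ne,
      ← h.apply_eq_self_iff]
    exact ⟨fun H => (H.apply_eq_self_iff).not.1 h1, fun H => h.isCycle.sameCycle h1 H⟩
  have hform : l.formPerm = f := by
    rw [hl, Equiv.Perm.formPerm_toList, h.isCycle.cycleOf_eq h1]
  have hf (i : ℕ) (hi : i + 1 < l.length) : f l[i] = l[i + 1] := by
    rw [← hform]
    exact List.formPerm_apply_lt_getElem l hnd i hi
  have hlen : l.length + 1 = n := by
    have : (a :: l).Nodup := List.nodup_cons.2 ⟨fun H => (hmem a).1 H rfl, hnd⟩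
    have hcard : (a :: l).toFinset = Finset.univ := by
      ext x
      simp [hmem, em]
    rw [← List.length_cons (a := a), ← List.toFinset_card_of_nodup this, hcard]
    simp
  obtain ⟨rest, hrest⟩ : ∃ rest, l = one :: rest := by
    have hpos : 0 < l.length := List.length_pos_of_mem ((hmem top).2
      (fun e => h.ne_top (by rw [← e, htop])))
    refine ⟨l.tail, ?_⟩
    have : l[0] = one := by simp [hl, Equiv.Perm.getElem_toList]
    rw [← this, ← List.head_eq_getElem (List.length_pos_iff.1 hpos), List.cons_head_tail]
  have htm : top ∈ rest := by
    have : top ∈ l := (hmem top).2 (fun e => h.ne_top (by rw [← e, htop]))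
    rw [hrest] at this
    exact (List.mem_cons.1 this).resolve_left h1N.symm
  obtain ⟨u, v, rfl⟩ := List.append_of_mem htm
  have hcl : cycleList hn u v.reverse = l := by
    rw [cycleList, List.reverse_reverse, hrest, hone, htop]
  have hlt := h.getElem_lt hnd hf (m := u.length + 1) (by simp [hrest]) (by simp [hrest, hone])
    (by simp [hrest, htop])
  refine ⟨u, v.reverse, ?_, ?_, ?_, ?_, ?_⟩
  · rw [hcl]
    exact List.nodup_cons.2 ⟨fun H => (hmem a).1 H rfl, hnd⟩
  · rw [hrest] at hlen
    simp only [List.length_cons, List.length_append, List.length_reverse] at hlen ⊢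
    omega
  -- For the transitive order it suffices to compare neighbours. The leading `1` shifts the indices
  -- of `u` in `l` by one.
  · rw [← List.isChain_iff_pairwise, List.isChain_iff_getElem]
    intro i hi
    have := (hlt (i + 1) (by simp [hrest]; omega)).1 (by omega)
    simpa [hrest, List.getElem_append_left (show i < u.length by omega),
      List.getElem_append_left hi] using this
  · rw [List.pairwise_reverse, ← List.isChain_iff_pairwise (R := fun a b => b < a),
      List.isChain_iff_getElem]
    intro i hi
    have := (hlt (u.length + 1 + 1 + i) (by simp [hrest]; omega)).2 (by omega)
    have e (j : ℕ) (hj : j < v.length) :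
        l[u.length + 1 + 1 + j]'(by simp [hrest]; omega) = v[j] := by
      simp only [hrest]
      rw [List.getElem_cons, dif_neg (by omega), List.getElem_append_right (by omega),
        List.getElem_cons, dif_neg (by omega)]
      congr 1
      omega
    rw [← e i (by omega), ← e (i + 1) hi]
    exact this
  · rw [hcl, hform]

end IsUnimodalCycle

end ArtinBraid

theorem proposition3p3 (n : ℕ) (hn : 3 ≤ n) (s : ArtinBraid.BraidGroup n) :
    (s ∈ ArtinBraid.USS (ArtinBraid.epsilon n) ↔
      ArtinBraid.IsSimple s ∧
        ∃ (a : ArtinBraid.Puncture n) (u d : List (ArtinBraid.Puncture n)),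
          ArtinBraid.HasEpsilonCycleForm (le_trans (by norm_num) hn)
            (ArtinBraid.perm s) a u d) ∧
    ∀ (a : ArtinBraid.Puncture n) (u d : List (ArtinBraid.Puncture n)),
      ArtinBraid.IsSimple s →
      ArtinBraid.HasEpsilonCycleForm (le_trans (by norm_num) hn) (ArtinBraid.perm s) a u d →
      (ArtinBraid.beta a d)⁻¹ * s * ArtinBraid.beta a d = ArtinBraid.epsilon n := by
  refine ⟨⟨fun h => ?_, ?_⟩, fun a u d hs h => ArtinBraid.beta_conj hn hs h⟩
  · have hs := ArtinBraid.isSimple_of_mem_USS_epsilon hn h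
    obtain ⟨a, ha⟩ := hs.isUnimodalCycle hn h.1
    exact ⟨hs, a, ha.exists_hasEpsilonCycleForm _⟩
  · rintro ⟨hs, a, u, d, h⟩
    exact ArtinBraid.mem_USS_epsilon_of_form hn hs h
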